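/- Consider the rank-six $U(1)$ tensorial field theory in momentum space, with gauge constraint set $\mathcal P=\{\vec p\in\mathbb Z^6:\sum_c p_c=0\}$, mass $m>0$, propagator with sharp ultraviolet cutoff $\rho\in\mathbb N$ (where $M>1$ is fixed) $$C^\rho(\vec p)=\frac{\delta(\sum_c p_c)\,\mathbf 1_{|\vec p|^2\le M^{2\rho}}}{|\vec p|^2+m^2},$$ and interaction $S_{int}=\lambda\sum_{c=1}^6 \mathrm{Tr}_{b_c}(\bar\phi\phi)$, where for $c=1$ $$\mathrm{Tr}_{b_1}(\bar\phi\phi)=\sum_{\vec p,\vec p\,'}\bar\phi(p_1,p_2,\dots,p_6)\,\phi(p'_1,p_2,\dots,p_6)\,\bar\phi(p'_1,p'_2,\dots,p'_6)\,\phi(p_1,p'_2,\dots,p'_6)$$ and similarly for the other colours. A vertex $b_c$ splits into two halves, each containing a $\bar\phi$ and a $\phi$ joined by the five strands of colours other than $c$. In the intermediate field representation the disks of a graph are the cyclic or open sequences of propagators and halves, each open one (ciliated disk) carrying one incoming and one outgoing external leg of equal momentum, and each vertex $b_c$ is a wavy edge of colour $c$ between the disks of its two halves. The vertex function $\Gamma_{2N}$,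 a function of the cutoff and of the momenta in $\mathcal P^N$ of the $N$ ciliated disks with values in $\mathbb R[[\lambda]]$, is the sum over connected one-particle irreducible amputated Feynman graphs with $N$ ciliated disks, the order $\lambda^n$ being $\frac{(-\lambda)^n}{n!}$ times the sum of the amplitudes of the graphs with $n$ labelled vertices. A graph is melonic if the 7-coloured graph obtained by joining the two external legs of each ciliated disk and giving colour $0$ to the propagators has degree zero (the degree is the sum of the genera of its jackets). A four-point graph is monocolour of colour $c$ if its two ciliated disks are joined by a path of wavy edges all of colour $c$. Let $\Gamma_2^{melo}$ be the part of $\Gamma_2$ coming from melonic graphs, $\Gamma_{4,mono}^{(c)}$ the part of $\Gamma_4$ coming from graphs monocolour of colour $c$, and $\Gamma_{4,mono}^{melo,(c)}$ the part of the latter coming from melonic graphs. The divergence degree of a graph is $\omega=-2L+F-R$, where $L$ is the number of internal lines, $F$ the number of internal faces and $R$ the rank of the line/internal-face incidence matrix. A sum of graphs is called superficially convergent if all its graphs have $\omega<0$. **Theorem.** There exist functions $f,g$ of the cutoff $\rho$ and of a single strand momentum $p\in\mathbb Z$, with values in $\mathbb R[[\lambda]]$, such that: 1. $f$ and $g$ are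 ultraviolet divergent: for every $p\in\mathbb Z$, the absolute value of the coefficient of $\lambda^k$ in $f(p)$ tends to $+\infty$ as $\rho\to\infty$ for every $k\ge 0$, and so does that of the coefficient of $\lambda^k$ in $g(p)$ for every $k\ge 1$ (the order $k=0$ of $g$ is the bare vertex); 2. for all $\rho$, all $\vec p,\vec p\,'\in\mathcal P$ and all colours $c$, $$\Gamma_2^{melo}(\vec p)=-\lambda\sum_{c'=1}^6 f(p_{c'}),\qquad \Gamma_{4,mono}^{melo,(c)}(\vec p,\vec p\,')=-\lambda\,\delta(p_c,p'_c)\,g(p_c).$$ Moreover $\Gamma_2-\Gamma_2^{melo}$ and, for every colour $c$, $\Gamma_{4,mono}^{(c)}-\Gamma_{4,mono}^{melo,(c)}$ are superficially convergent (being the sums of the corresponding non-melonic graphs). So is $\Gamma_4-\sum_{c}\Gamma_{4,mono}^{melo,(c)}$, the sum of the one-particle irreducible four-point graphs that are not both melonic and monocolour, and so are all the higher vertex functions $\Gamma_{2N}$, $N\ge 3$. -/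

import Mathlib

/-! Perturbation theory of the rank six `U(1)` tensorial field theory with gauge-invariant
Laplacian propagator and colour-symmetric quartic melonic interaction
`S_int = lam * ∑ c, Tr_{b_c}(φbar φ)`, in momentum space, with a sharp ultraviolet cutoff. -/

namespace TGFT

open Filter Topology

noncomputable section

/-- Momenta `(p_1, …, p_6)` of the six strands. -/
abbrev Momentum : Type := Fin 6 → ℤ

/-- Momenta satisfying the gauge constraint `∑ c, p_c = 0`. -/
abbrev GaugeMomentum : Type := {p : Momentum // ∑ c, p c = 0}

/-- The propagator `δ(∑ c, p_c) / (|p|² + m²)` with the sharp cutoff `|p|² ≤ M^(2ρ)`. -/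
def propagator (m M : ℝ) (ρ : ℕ) (p : Momentum) : ℝ :=
  if ∑ c, p c = 0 ∧ ∑ c, (p c : ℝ) ^ 2 ≤ M ^ (2 * ρ) then 1 / (∑ c, (p c : ℝ) ^ 2 + m ^ 2) else 0

/-- The two halves of each of `n` quartic vertices. The half `(v, i)` carries one white node
(a field `φbar`) and one black node (a field `φ`). -/
abbrev Half (n : ℕ) : Type := Fin n × Bool

/-- A labelled amputated Feynman graph with `n` quartic vertices and `2N` external legs.

* `color v = c` says that the vertex `v` is the bubble `b_c`: in it the white and black nodes of
  the same half are joined by the five strands of colours other than `c`, and the strand of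
  colour `c` joins the white node of each half to the black node of the other half.
* `wick` contracts the black node of `d` with the white node of `wick d`; this arc is called `d`.
  The cycles of `wick` are the disks of the intermediate field representation, and the vertices
  are its wavy edges: `v` joins the disks of `(v, false)` and `(v, true)` and has colour `color v`.
* The arc `cilium j` is cut, and its two ends are the external legs number `j` (one exit at the
  black node of `cilium j`, one entrance at the white node of `wick (cilium j)`). All the other
  arcs are the internal lines.
* A disk bears at most one cilium, so that the strands entering at the leg `j` also exit at the
  leg `j`, with the same momentum. (The other contractions only permute the labels of the exits.)
-/
@[ext]
structure FeynmanGraph (n N : ℕ) : Type where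
  color : Fin n → Fin 6
  wick : Equiv.Perm (Half n)
  cilium : Fin N → Half n
  eq_of_sameCycle : ∀ i j, wick.SameCycle (cilium i) (cilium j) → i = j

instance (n N : ℕ) : Finite (FeynmanGraph n N) :=
  Finite.of_injective
    (fun G => (G.color, G.wick, G.cilium) :
      FeynmanGraph n N → (Fin n → Fin 6) × Equiv.Perm (Half n) × (Fin N → Half n))
    (by
      intro G H h
      simp only [Prod.mk.injEq] at h
      exact FeynmanGraph.ext h.1 h.2.1 h.2.2)

instance (n N : ℕ) : Fintype (FeynmanGraph n N) := Fintype.ofFinite _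

namespace FeynmanGraph

variable {n N : ℕ} (G : FeynmanGraph n N)

/-- The strand of colour `c` at the white node of `d` leads to the black node of `partner c d`. -/
def partner (c : Fin 6) : Equiv.Perm (Half n) :=
  Function.Involutive.toPerm
    (fun d => if G.color d.1 = c then (d.1, !d.2) else d)
    (by
      intro d
      by_cases h : G.color d.1 = c <;> simp [h])

/-- The internal lines: the arcs that are not cut. -/
abbrev Line : Type := {d : Half n // d ∉ Set.range G.cilium}

instance : Fintype G.Line := Fintype.ofFinite _

/-! ### Amplitudes -/

/-- The amputated amplitude. A momentum `K d` is attributed to every arc, equal to the external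
momentum `p j` on the cut arc number `j`; at every vertex the strands impose the equality of the
momenta that they join; every internal line bears a propagator. Only finitely many `K` give a
non-zero term. -/
def amplitude (m M : ℝ) (ρ : ℕ) (p : Fin N → GaugeMomentum) : ℝ :=
  open Classical in
  ∑' K : Half n → Momentum,
    if (∀ j, K (G.cilium j) = (p j).1) ∧
        (∀ d c, K (G.wick.symm d) c = K (G.partner c d) c) then
      ∏ l : G.Line, propagator m M ρ (K l.1)
    else 0

/-! ### One-particle irreducibility -/

/-- The graph on the vertices whose edges are the arcs in `S`. -/
def vertexGraph (S : Set (Half n)) : SimpleGraph (Fin n) :=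
  SimpleGraph.fromRel fun v w => ∃ d ∈ S, d.1 = v ∧ (G.wick d).1 = w

/-- The graph is connected and remains so if any one internal line is removed. -/
def IsOnePI : Prop :=
  (G.vertexGraph (Set.range G.cilium)ᶜ).Connected ∧
    ∀ l ∉ Set.range G.cilium, (G.vertexGraph ((Set.range G.cilium)ᶜ \ {l})).Connected

/-! ### Divergence degree -/

/-- The faces of colour `c`, before the external arcs are cut, are the cycles of this
permutation of the arcs. -/
def facePerm (c : Fin 6) : Equiv.Perm (Half n) := G.partner c * G.wick

/-- The faces of colour `c` before the external arcs are cut. -/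
abbrev Face (c : Fin 6) : Type := Quotient (Equiv.Perm.SameCycle.setoid (G.facePerm c))

/-- The face of colour `c` through the arc `d`. -/
def faceOf (c : Fin 6) (d : Half n) : G.Face c := Quotient.mk _ d

/-- The internal (closed) faces: those that contain no cut arc. -/
abbrev InternalFace : Type :=
  {f : Σ c, G.Face c // ∀ j, G.faceOf f.1 (G.cilium j) ≠ f.2}

instance : Fintype G.InternalFace := Fintype.ofFinite _

/-- The incidence matrix of internal lines and internal faces. As the lines join black to white
nodes, all the signs are `+1`. -/
def incidence : Matrix G.Line G.InternalFace ℚ :=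
  open Classical in
  fun l f => if G.faceOf f.1.1 l.1 = f.1.2 then 1 else 0

/-- The divergence degree `ω = -2L + F - R`. -/
def divergenceDegree : ℤ :=
  -2 * (Fintype.card G.Line : ℤ) + (Fintype.card G.InternalFace : ℤ) - (G.incidence.rank : ℤ)

/-! ### Melonic graphs -/

/-- The edges of the 7-regular bipartite coloured graph associated with `G` (with the external
legs number `j` joined together again): the edge of colour `i` at the white node of `d` leads to
the black node of `coloredEdge i d`. The colour `0` is that of the propagators, and `c.succ` is
the strand colour `c`. -/
def coloredEdge (i : Fin 7) : Equiv.Perm (Half n) :=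
  Fin.cases G.wick.symm G.partner i

/-- The number of faces of colours `i`, `j` of the coloured graph. -/
def numBicolored (i j : Fin 7) : ℕ :=
  Nat.card (Quotient (Equiv.Perm.SameCycle.setoid ((G.coloredEdge i)⁻¹ * G.coloredEdge j)))

/-- The genus of the jacket of the 7-cycle `ξ`, from Euler's formula `V - E + F = 2 - 2g`.
There are `2 * (2n)` nodes, `7 * (2n)` edges, and the faces are those of colours `i`, `ξ i`. -/
def jacketGenus (ξ : Equiv.Perm (Fin 7)) : ℚ :=
  1 - ((2 * (2 * n) : ℚ) - 7 * (2 * n) + ∑ i, (G.numBicolored i (ξ i) : ℚ)) / 2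

/-- The degree of the associated (closed) coloured graph: the sum of the genera of all jackets. A jacket is a 7-cycle up to orientation,
whence the factor `1/2`. -/
def degree : ℚ :=
  open Classical in
  (∑ ξ : Equiv.Perm (Fin 7) with ξ.IsCycle ∧ ξ.support = Finset.univ, G.jacketGenus ξ) / 2

/-- Melonic graphs are those of degree zero. -/
def IsMelonic : Prop := G.degree = 0

/-- In the intermediate field representation the two ciliated disks of a four-point graph are
joined by a path of wavy edges that all have the colour `c`. -/
def IsMono (G : FeynmanGraph n 2) (c : Fin 6) : Prop :=
  Relation.EqvGen
    (fun d d' => G.wick.SameCycle d d' ∨ (G.color d.1 = c ∧ d' = (d.1, !d.2)))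
    (G.cilium 0) (G.cilium 1)

end FeynmanGraph

/-! ### Vertex functions -/

/-- A class of graphs with `2N` external legs. -/
abbrev GraphClass (N : ℕ) : Type := ∀ n, Set (FeynmanGraph n N)

/-- A function of the cutoff `ρ` and of `N` external momenta, with values in the formal power
series in the coupling constant. -/
abbrev FormalFunction (N : ℕ) : Type := ℕ → (Fin N → GaugeMomentum) → PowerSeries ℝ

/-- The sum of the graphs of the class `S`: the coefficient of `lam ^ n` is `(-1) ^ n / n!` times
the sum of the amplitudes of the labelled graphs of order `n`. -/
def feynmanSum (m M : ℝ) {N : ℕ} (S : GraphClass N) : FormalFunction N := fun ρ p =>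
  open Classical in
  PowerSeries.mk fun n =>
    (-1) ^ n / (n.factorial : ℝ) *
      ∑ G : FeynmanGraph n N, if G ∈ S n then G.amplitude m M ρ p else 0

/-- The one-particle irreducible graphs. -/
def onePI (N : ℕ) : GraphClass N := fun _ => {G | G.IsOnePI}

/-- The one-particle irreducible melonic graphs. -/
def onePIMelonic (N : ℕ) : GraphClass N := fun _ => {G | G.IsOnePI ∧ G.IsMelonic}

/-- The one-particle irreducible four-point graphs that are monocolour of colour `c`. -/
def onePIMono (c : Fin 6) : GraphClass 2 := fun _ => {G | G.IsOnePI ∧ G.IsMono c}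

/-- The melonic one-particle irreducible four-point graphs that are monocolour of colour `c`. -/
def onePIMelonicMono (c : Fin 6) : GraphClass 2 :=
  fun _ => {G | G.IsOnePI ∧ G.IsMelonic ∧ G.IsMono c}

/-- The vertex function `Γ_{2N}`. -/
def vertexFunction (m M : ℝ) (N : ℕ) : FormalFunction N := feynmanSum m M (onePI N)

/-- `Γ_2^{melo}`. -/
def vertexTwoMelo (m M : ℝ) : FormalFunction 1 := feynmanSum m M (onePIMelonic 1)

/-- The part `Γ_{4,mono}` of `Γ_4` of colour `c`. -/
def vertexFourMono (m M : ℝ) (c : Fin 6) : FormalFunction 2 := feynmanSum m M (onePIMono c)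

/-- `Γ_{4,mono}^{melo}` for the colour `c`. -/
def vertexFourMonoMelo (m M : ℝ) (c : Fin 6) : FormalFunction 2 :=
  feynmanSum m M (onePIMelonicMono c)

/-- `Γ` is superficially convergent: it is the sum of the graphs of the class `S`, all of which
have a negative divergence degree. -/
structure IsSuperficiallyConvergent (m M : ℝ) {N : ℕ} (S : GraphClass N)
    (Γ : FormalFunction N) : Prop where
  expansion : Γ = feynmanSum m M S
  degree_neg : ∀ n, ∀ G ∈ S n, G.divergenceDegree < 0

/-- The coefficient of order `k` of a cutoff-dependent formal power series is ultraviolet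
divergent: it tends to infinity in absolute value when the cutoff is removed. -/
def DivergesAtOrder (F : ℕ → PowerSeries ℝ) (k : ℕ) : Prop :=
  Tendsto (fun ρ => |PowerSeries.coeff k (F ρ)|) atTop atTop

end

end TGFT

/-! In the intermediate field representation a graph is a map: its D disks are the cycles of `wick`,
its n wavy edges are the quartic vertices. A one-particle irreducible graph is connected, so D ≤ n +
1, with equality exactly for trees (`IsLinked.numCycles_le`). Averaging over jackets turns the
degree into a positive multiple of 6 + 5n - ∑ F_c, where F_c counts the faces of colours 0 and c,
and genus bounds show that it vanishes exactly for trees (`isMelonic_iff`).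

Power counting: F - R is the dimension of the kernel of the incidence matrix. Conservation of five
strand momenta at each half and the gauge constraint make a kernel vector constant along each disk,
so it is a field of sum-zero vectors on the disks, equal in component c across edges of colour c and
zero on the ciliated disks. Starting from those and adding adjacent disks one by one, each new disk
brings at most 5 - 1 = 4 dimensions. Hence ω ≤ 4(D - n) - 2N (`divergenceDegree_le_of_isLinked`),
which is negative unless the graph is a tree with N ≤ 2. If N = 2 and the two ciliated disks are not
joined in a single colour, some disk shares two colours with those already placed and brings only 3
(`finrank_fieldSpace_lt`), so ω < 0 again.

In a melonic one-particle irreducible graph the ciliated disks are leaves (`IsOnePI.wick_cilium`),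
so the amplitude sees only the external component of the colour of the leaf's edge. Recolouring that
edge to 0 gives the same f and g for all colours. Amplitudes are nonnegative, so at each order one
star-shaped tree suffices for divergence, and its amplitude dominates a harmonic series. -/

namespace TGFT

open Equiv Module

/-! ### Dimension counts for gauge-constrained vectors -/

section LinearAlgebra

/-- Rank-nullity for `ℓ` restricted to `W`. It measures the dimension lost when a linear condition
is imposed. -/
theorem finrank_le_finrank_add_of_map {V V₂ : Type*} [AddCommGroup V] [Module ℚ V]
    [FiniteDimensional ℚ V] [AddCommGroup V₂] [Module ℚ V₂] [FiniteDimensional ℚ V₂]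
    {W W' : Submodule ℚ V} (ℓ : V →ₗ[ℚ] V₂) (R : Submodule ℚ V₂)
    (hmap : ∀ w ∈ W, ℓ w ∈ R) (hker : ∀ w ∈ W, ℓ w = 0 → w ∈ W') :
    finrank ℚ W ≤ finrank ℚ W' + finrank ℚ R := by
  have h := LinearMap.finrank_range_add_finrank_ker (ℓ.restrict hmap)
  have h₁ := Submodule.finrank_le (LinearMap.range (ℓ.restrict hmap))
  have h₂ : finrank ℚ (LinearMap.ker (ℓ.restrict hmap)) ≤ finrank ℚ W' := by
    rw [← Submodule.finrank_map_subtype_eq W]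
    apply Submodule.finrank_mono
    rintro _ ⟨w, hw, rfl⟩
    refine hker _ w.2 ?_
    have := congrArg Subtype.val (LinearMap.mem_ker.1 hw)
    simpa using this
  omega

/-- The vectors of coordinate sum zero that vanish on `T`. -/
def gaugeSpace (T : Finset (Fin 6)) : Submodule ℚ (Fin 6 → ℚ) where
  carrier := {x | ∑ c, x c = 0 ∧ ∀ c ∈ T, x c = 0}
  add_mem' := by
    rintro x y ⟨hx, hx'⟩ ⟨hy, hy'⟩
    refine ⟨by simp [Finset.sum_add_distrib, hx, hy], fun c hc => by simp [hx' c hc, hy' c hc]⟩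
  zero_mem' := by simp
  smul_mem' := by
    rintro a x ⟨hx, hx'⟩
    refine ⟨by simp [← Finset.mul_sum, hx], fun c hc => by simp [hx' c hc]⟩

/-- The coordinate `i` is the one solved for by the gauge constraint; it must lie outside `T` for
that constraint to be independent of the vanishing on `T`. -/
theorem finrank_gaugeSpace_le {T : Finset (Fin 6)} {i : Fin 6} (hi : i ∉ T) :
    finrank ℚ (gaugeSpace T) ≤ 5 - T.card := by
  have h := finrank_le_finrank_add_of_map (W := gaugeSpace T) (W' := ⊥)
    (LinearMap.funLeft ℚ ℚ (Subtype.val : {c // c ∉ insert i T} → Fin 6)) ⊤ (by simp) (by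
      rintro x ⟨hx, hx'⟩ h0
      have hoff : ∀ c, c ≠ i → x c = 0 := by
        intro c hc
        by_cases hT : c ∈ T
        · exact hx' c hT
        · exact congrFun h0 ⟨c, by simp [hc, hT]⟩
      rw [Submodule.mem_bot]
      ext c
      by_cases hc : c = i
      · subst hc
        rwa [Finset.sum_eq_single c (fun b _ hb => hoff b hb) (by simp)] at hx
      · exact hoff c hc)
  rw [finrank_bot, finrank_top, finrank_fintype_fun_eq_card, Fintype.card_subtype_compl] at h
  simp only [Fintype.card_fin, Fintype.card_coe, Finset.card_insert_of_notMem hi] at h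
  omega

end LinearAlgebra

/-! ### Cycle counts as dimensions, and their change under transpositions -/

section Permutations

variable {α : Type*}

/-- The rational functions that are constant along the cycles of a permutation. -/
def invariants (σ : Perm α) : Submodule ℚ (α → ℚ) where
  carrier := {φ | ∀ a, φ (σ a) = φ a}
  add_mem' := by
    intro φ ψ hφ hψ a
    simp [hφ a, hψ a]
  zero_mem' := by simp
  smul_mem' := by
    intro r φ hφ a
    simp [hφ a]

theorem mem_invariants {σ : Perm α} {φ : α → ℚ} : φ ∈ invariants σ ↔ ∀ a, φ (σ a) = φ a :=
  Iff.rfl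

theorem apply_eq_of_sameCycle {β : Type*} {σ : Perm α} {φ : α → β} (h : ∀ a, φ (σ a) = φ a)
    {a b : α} (hab : σ.SameCycle a b) : φ a = φ b := by
  obtain ⟨i, rfl⟩ := hab
  have key : ∀ j : ℕ, ∀ x, φ ((σ ^ j) x) = φ x := by
    intro j
    induction j with
    | zero => simp
    | succ j ih => intro x; rw [pow_succ', Perm.mul_apply, h, ih]
  cases i with
  | ofNat j => simpa using (key j a).symm
  | negSucc j =>
    rw [zpow_negSucc, ← key (j + 1) (((σ ^ (j + 1))⁻¹) a)]
    simp

/-- The number of cycles (fixed points included). -/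
noncomputable def numCycles (σ : Perm α) : ℕ := finrank ℚ (invariants σ)

/-- Functions on the set of cycles pull back bijectively onto invariant functions. With dimensions,
splitting and merging of cycles become linear algebra. -/
theorem card_quotient_sameCycle [Finite α] (σ : Perm α) :
    Nat.card (Quotient (Perm.SameCycle.setoid σ)) = numCycles σ := by
  classical
  have := Fintype.ofFinite (Quotient (Perm.SameCycle.setoid σ))
  have hinj := LinearMap.funLeft_injective_of_surjective ℚ ℚ
    (Quotient.mk (Perm.SameCycle.setoid σ)) Quotient.mk_surjective
  have hrange : LinearMap.range (LinearMap.funLeft ℚ ℚ (Quotient.mk (Perm.SameCycle.setoid σ))) =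
      invariants σ := by
    ext φ
    constructor
    · rintro ⟨ψ, rfl⟩ a
      refine congrArg ψ (Quotient.sound ?_)
      exact (Perm.sameCycle_apply_left).2 (Perm.SameCycle.refl σ a)
    · intro hφ
      exact ⟨Quotient.lift φ fun a b hab => apply_eq_of_sameCycle hφ hab, rfl⟩
  rw [numCycles, ← hrange, LinearMap.finrank_range_of_inj hinj, finrank_fintype_fun_eq_card,
    Nat.card_eq_fintype_card]

theorem numCycles_inv (σ : Perm α) : numCycles σ⁻¹ = numCycles σ := by
  have : invariants σ⁻¹ = invariants σ := by
    ext φ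
    constructor
    · intro h a
      simpa using (h (σ a)).symm
    · intro h a
      simpa using (h (σ⁻¹ a)).symm
  rw [numCycles, this, numCycles]

theorem finrank_le_of_eq_at [Finite α] {W W' : Submodule ℚ (α → ℚ)} (x y : α)
    (h : ∀ φ ∈ W, φ x = φ y → φ ∈ W') : finrank ℚ W ≤ finrank ℚ W' + 1 := by
  have := finrank_le_finrank_add_of_map (W := W) (W' := W')
    (LinearMap.proj (R := ℚ) (φ := fun _ : α => ℚ) x - LinearMap.proj y) ⊤ (by simp)
    (fun φ hφ h0 => h φ hφ (by simpa [sub_eq_zero] using h0))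
  simpa using this

variable [DecidableEq α]

theorem mul_swap_mem_invariants {σ : Perm α} {x y : α} {φ : α → ℚ} (hφ : φ ∈ invariants σ)
    (hxy : φ x = φ y) : φ ∈ invariants (σ * swap x y) := by
  intro a
  rw [Perm.mul_apply, hφ]
  by_cases hx : a = x
  · subst hx; simp [hxy]
  · by_cases hy : a = y
    · subst hy; simp [hxy]
    · rw [swap_apply_of_ne_of_ne hx hy]

variable [Finite α]

theorem numCycles_le_mul_swap (σ : Perm α) (x y : α) :
    numCycles σ ≤ numCycles (σ * swap x y) + 1 :=
  finrank_le_of_eq_at x y fun _ hφ h => mul_swap_mem_invariants hφ h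

theorem numCycles_mul_swap_le (σ : Perm α) (x y : α) :
    numCycles (σ * swap x y) ≤ numCycles σ + 1 := by
  simpa [mul_assoc] using numCycles_le_mul_swap (σ * swap x y) x y

/-- If `x` and `y` are in different cycles of `σ`, then `σ * swap x y` merges these cycles. -/
theorem numCycles_mul_swap_lt {σ : Perm α} {x y : α} {ψ : α → ℚ} (hψ : ψ ∈ invariants σ)
    (hxy : ψ x ≠ ψ y) : numCycles (σ * swap x y) < numCycles σ := by
  have := Fintype.ofFinite α
  have key : ∀ φ ∈ invariants (σ * swap x y), φ x = φ y := by
    intro φ hφ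
    -- The level set of `ψ` through `y` is stable under `σ` and misses `x`. In it `φ (σ a) = φ a`
    -- except perhaps at `y`, so equality of the two sums forces it at `y` too; and `φ (σ y) = φ x`.
    have hsum : ∑ a with ψ a = ψ y, φ (σ a) = ∑ a with ψ a = ψ y, φ a := by
      refine Finset.sum_equiv σ (fun a => by simp [hψ a]) (fun a _ => rfl)
    have hy : y ∈ Finset.univ.filter (fun a => ψ a = ψ y) := by simp
    rw [← Finset.add_sum_erase _ _ hy, ← Finset.add_sum_erase _ _ hy] at hsum
    have hrest : ∑ a ∈ (Finset.univ.filter (fun a => ψ a = ψ y)).erase y, φ (σ a) =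
        ∑ a ∈ (Finset.univ.filter (fun a => ψ a = ψ y)).erase y, φ a := by
      refine Finset.sum_congr rfl fun a ha => ?_
      rw [Finset.mem_erase, Finset.mem_filter] at ha
      have hax : a ≠ x := by
        rintro rfl
        exact hxy ha.2.2
      have := hφ a
      rwa [Perm.mul_apply, swap_apply_of_ne_of_ne hax ha.1] at this
    have hx := hφ x
    rw [Perm.mul_apply, swap_apply_left] at hx
    rw [hrest, hx] at hsum
    exact add_right_cancel hsum
  -- The inclusion is strict because `ψ` itself separates `x` from `y`.
  refine Submodule.finrank_lt_finrank_of_lt (lt_of_le_of_ne ?_ ?_)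
  · intro φ hφ
    have := mul_swap_mem_invariants hφ (key φ hφ)
    simpa [mul_assoc] using this
  · intro h
    exact hxy (key ψ (h ▸ hψ))

theorem numCycles_mul_swap_of_isFixed {σ : Perm α} {x y : α} (hx : σ x = x) (hne : x ≠ y) :
    numCycles (σ * swap x y) + 1 = numCycles σ := by
  have h₁ := numCycles_le_mul_swap σ x y
  have h₂ := numCycles_mul_swap_lt (σ := σ) (x := x) (y := y) (ψ := Pi.single x 1)
    (by
      intro a
      have : σ a = x ↔ a = x := by
        constructor
        · intro h; exact σ.injective (h.trans hx.symm)
        · rintro rfl; exact hx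
      by_cases h : a = x
      · subst h; simp [hx]
      · rw [Pi.single_eq_of_ne h, Pi.single_eq_of_ne (fun h' => h (this.1 h'))])
    (by rw [Pi.single_eq_same, Pi.single_eq_of_ne hne.symm]; exact one_ne_zero)
  omega

end Permutations

end TGFT

namespace TGFT

open Equiv Module

/-! ### Disks, edges and faces of combinatorial maps -/

section Flips

variable {n : ℕ}

/-- The exchange of the two halves of each of the vertices in `S`. -/
def flip (S : Finset (Fin n)) : Perm (Half n) :=
  Function.Involutive.toPerm (fun d => if d.1 ∈ S then (d.1, !d.2) else d)
    (by
      intro d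
      by_cases h : d.1 ∈ S <;> simp [h])

theorem flip_apply (S : Finset (Fin n)) (d : Half n) :
    flip S d = if d.1 ∈ S then (d.1, !d.2) else d := rfl

theorem flip_empty : flip (∅ : Finset (Fin n)) = 1 := by
  ext d <;> simp [flip_apply]

theorem flip_inv (S : Finset (Fin n)) : (flip S)⁻¹ = flip S := by
  rw [inv_eq_iff_mul_eq_one]
  ext d <;> by_cases h : d.1 ∈ S <;> simp [flip_apply, h]

theorem flip_mul_flip {S T : Finset (Fin n)} (h : Disjoint S T) :
    flip S * flip T = flip (S ∪ T) := by
  apply Equiv.ext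
  rintro ⟨v, b⟩
  by_cases hT : v ∈ T
  · have := Finset.disjoint_right.1 h hT
    simp [flip_apply, hT, this]
  · simp [flip_apply, hT]

theorem flip_singleton (v : Fin n) : flip {v} = swap (v, false) (v, true) := by
  apply Equiv.ext
  rintro ⟨u, b⟩
  by_cases h : u = v
  · subst h
    cases b <;> simp [flip_apply]
  · rw [swap_apply_of_ne_of_ne] <;> simp [flip_apply, h]

theorem flip_insert {S : Finset (Fin n)} {v : Fin n} (hv : v ∉ S) :
    flip (insert v S) = flip S * swap (v, false) (v, true) := by
  rw [← flip_singleton, flip_mul_flip (by simpa using hv), Finset.union_comm, Finset.insert_eq]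

theorem numCycles_one : numCycles (1 : Perm (Half n)) = 2 * n := by
  have : invariants (1 : Perm (Half n)) = ⊤ := by
    ext φ
    simp [mem_invariants]
  rw [numCycles, this, finrank_top, finrank_fintype_fun_eq_card]
  simp [mul_comm]

theorem numCycles_flip (S : Finset (Fin n)) : numCycles (flip S) + S.card = 2 * n := by
  induction S using Finset.induction_on with
  | empty => simp [flip_empty, numCycles_one]
  | insert v S hv ih =>
    rw [flip_insert hv, Finset.card_insert_of_notMem hv, ← ih, ← numCycles_mul_swap_of_isFixed
      (σ := flip S) (x := (v, false)) (y := (v, true)) (by simp [flip_apply, hv]) (by simp)]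
    ring

/-- The functions on the cycles of `w` that agree on the two halves of each vertex in `S`. -/
def linked (w : Perm (Half n)) (S : Finset (Fin n)) : Submodule ℚ (Half n → ℚ) where
  carrier := {φ | φ ∈ invariants w ∧ ∀ v ∈ S, φ (v, false) = φ (v, true)}
  add_mem' := by
    rintro φ ψ ⟨hφ, hφ'⟩ ⟨hψ, hψ'⟩
    exact ⟨add_mem hφ hψ, fun v hv => by simp [hφ' v hv, hψ' v hv]⟩
  zero_mem' := ⟨zero_mem _, by simp⟩
  smul_mem' := by
    rintro r φ ⟨hφ, hφ'⟩
    exact ⟨Submodule.smul_mem _ r hφ, fun v hv => by simp [hφ' v hv]⟩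

/-- The cycles of `w * flip S` are the faces of the map with edges `S`, and a face stays within one
connected component. -/
theorem linked_le_invariants (w : Perm (Half n)) (S : Finset (Fin n)) :
    linked w S ≤ invariants (w * flip S) := by
  rintro φ ⟨hφ, hS⟩ ⟨v, b⟩
  rw [Perm.mul_apply, hφ, flip_apply]
  split_ifs with h
  · cases b
    · exact (hS v h).symm
    · exact hS v h
  · rfl

theorem linked_empty (w : Perm (Half n)) : linked w ∅ = invariants w := by
  ext φ
  exact ⟨fun h => h.1, fun h => ⟨h, by simp⟩⟩

theorem linked_inf_linked (w : Perm (Half n)) (S T : Finset (Fin n)) :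
    linked w S ⊓ linked w T = linked w (S ∪ T) := by
  ext φ
  constructor
  · rintro ⟨⟨h, hS⟩, -, hT⟩
    refine ⟨h, fun v hv => ?_⟩
    rcases Finset.mem_union.1 hv with hv | hv
    exacts [hS v hv, hT v hv]
  · rintro ⟨h, hST⟩
    exact ⟨⟨h, fun v hv => hST v (Finset.mem_union_left _ hv)⟩,
      ⟨h, fun v hv => hST v (Finset.mem_union_right _ hv)⟩⟩

theorem finrank_linked_le_insert (w : Perm (Half n)) (S : Finset (Fin n)) (v : Fin n) :
    finrank ℚ (linked w S) ≤ finrank ℚ (linked w (insert v S)) + 1 := by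
  refine finrank_le_of_eq_at (v, false) (v, true) fun φ hφ h => ⟨hφ.1, fun u hu => ?_⟩
  rcases Finset.mem_insert.1 hu with rfl | hu
  exacts [h, hφ.2 u hu]

theorem numCycles_le_finrank_linked_add (w : Perm (Half n)) (S : Finset (Fin n)) :
    numCycles w ≤ finrank ℚ (linked w S) + S.card := by
  induction S using Finset.induction_on with
  | empty => rw [linked_empty, Finset.card_empty, add_zero, numCycles]
  | insert v S hv ih =>
    rw [Finset.card_insert_of_notMem hv]
    have := finrank_linked_le_insert w S v
    omega

theorem numCycles_le_mul_flip_add (w : Perm (Half n)) (S : Finset (Fin n)) :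
    numCycles w ≤ numCycles (w * flip S) + S.card := by
  induction S using Finset.induction_on with
  | empty => simp [flip_empty]
  | insert v S hv ih =>
    rw [flip_insert hv, Finset.card_insert_of_notMem hv, ← mul_assoc]
    have := numCycles_le_mul_swap (w * flip S) (v, false) (v, true)
    omega

/-- Non-negativity of the genus of the map with disks the cycles of `w` and edges in `S`. -/
theorem numCycles_mul_flip_add_le (w : Perm (Half n)) (S : Finset (Fin n)) :
    numCycles (w * flip S) + numCycles w ≤ 2 * finrank ℚ (linked w S) + S.card := by
  induction S using Finset.induction_on with
  | empty => rw [flip_empty, mul_one, linked_empty, Finset.card_empty, add_zero, two_mul, numCycles]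
  | insert v S hv ih =>
    rw [flip_insert hv, Finset.card_insert_of_notMem hv, ← mul_assoc]
    -- An edge inside a component creates at most one face. An edge between two components merges
    -- two faces, since `φ` separates them, and removes at most one component.
    by_cases h : ∀ φ ∈ linked w S, φ (v, false) = φ (v, true)
    · have h₁ : linked w S ≤ linked w (insert v S) := by
        intro φ hφ
        refine ⟨hφ.1, fun u hu => ?_⟩
        rcases Finset.mem_insert.1 hu with rfl | hu
        exacts [h φ hφ, hφ.2 u hu]
      have h₂ := Submodule.finrank_mono h₁
      have h₃ := numCycles_mul_swap_le (w * flip S) (v, false) (v, true)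
      omega
    · push Not at h
      obtain ⟨φ, hφ, hne⟩ := h
      have h₁ := numCycles_mul_swap_lt (linked_le_invariants w S hφ) hne
      have h₂ := finrank_linked_le_insert w S v
      omega

/-- The graph whose vertices are the cycles of `w` and whose edges join the two halves of each of
the `n` vertices is connected. -/
def IsLinked (w : Perm (Half n)) : Prop :=
  ∀ φ ∈ linked w Finset.univ, ∀ d d', φ d = φ d'

theorem IsLinked.finrank_le_one {w : Perm (Half n)} (h : IsLinked w) :
    finrank ℚ (linked w Finset.univ) ≤ 1 := by
  refine _root_.finrank_le_one (⟨fun _ => 1, ⟨fun _ => rfl, fun _ _ => rfl⟩⟩ : linked w Finset.univ) ?_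
  rintro ⟨φ, hφ⟩
  by_cases hd : Nonempty (Half n)
  · obtain ⟨d⟩ := hd
    refine ⟨φ d, Subtype.ext (funext fun d' => ?_)⟩
    simp [h φ hφ d d']
  · exact ⟨0, Subtype.ext (funext fun d' => (hd ⟨d'⟩).elim)⟩

theorem IsLinked.numCycles_le {w : Perm (Half n)} (h : IsLinked w) : numCycles w ≤ n + 1 := by
  have h₁ := numCycles_le_finrank_linked_add w Finset.univ
  have h₂ := h.finrank_le_one
  rw [Finset.card_univ, Fintype.card_fin] at h₁
  omega

/-- Induction on the dimension formula for `⊔` and `⊓`, all suprema lying in `invariants w`. It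
bounds the total number of components of the monochromatic submaps. -/
theorem sum_finrank_linked_add_le (w : Perm (Half n)) {ι : Type*} [DecidableEq ι] (T : Finset ι)
    (S : ι → Finset (Fin n)) :
    ∑ c ∈ T, finrank ℚ (linked w (S c)) + numCycles w ≤
      T.card * numCycles w + finrank ℚ (linked w (T.biUnion S)) := by
  induction T using Finset.induction_on with
  | empty =>
    rw [Finset.biUnion_empty, linked_empty, Finset.sum_empty, Finset.card_empty, zero_mul, numCycles]
  | insert c T hc ih =>
    rw [Finset.sum_insert hc, Finset.card_insert_of_notMem hc, Finset.biUnion_insert,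
      ← linked_inf_linked]
    have h₁ := Submodule.finrank_sup_add_finrank_inf_eq (linked w (S c)) (linked w (T.biUnion S))
    have h₂ : finrank ℚ ↥(linked w (S c) ⊔ linked w (T.biUnion S)) ≤ numCycles w :=
      Submodule.finrank_mono (sup_le (fun φ hφ => hφ.1) (fun φ hφ => hφ.1))
    rw [add_mul, one_mul]
    omega

end Flips

/-! ### Melonic graphs are the trees -/

namespace FeynmanGraph

variable {n N : ℕ} (G : FeynmanGraph n N)

/-- The vertices of colour `c`. -/
def colored (c : Fin 6) : Finset (Fin n) := {v | G.color v = c}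

theorem partner_apply (c : Fin 6) (d : Half n) :
    G.partner c d = if G.color d.1 = c then (d.1, !d.2) else d := rfl

theorem partner_eq_flip (c : Fin 6) : G.partner c = flip (G.colored c) := by
  apply Equiv.ext
  intro d
  simp [partner_apply, flip_apply, colored]

theorem sum_card_colored : ∑ c, (G.colored c).card = n := by
  have := Finset.card_eq_sum_card_fiberwise (f := G.color) (s := Finset.univ) (t := Finset.univ)
    (fun _ _ => Finset.mem_coe.2 (Finset.mem_univ _))
  rw [Finset.card_univ, Fintype.card_fin] at this
  exact this.symm

theorem disjoint_colored {c c' : Fin 6} (h : c ≠ c') :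
    Disjoint (G.colored c) (G.colored c') := by
  rw [Finset.disjoint_left]
  intro v hv hv'
  simp only [colored, Finset.mem_filter, Finset.mem_univ, true_and] at hv hv'
  exact h (hv.symm.trans hv')

/-- The number of faces (external arcs being uncut) is extremal for the trees. -/
theorem sum_numCycles_eq_iff (h : IsLinked G.wick) :
    ∑ c, numCycles (G.wick * G.partner c) = 5 * n + 6 ↔ numCycles G.wick = n + 1 := by
  -- With D disks, k ≤ 1 components and k_c components in colour c: ∑ F_c + 6D ≤ 2 ∑ k_c + n and ∑
  -- k_c ≤ 5D + k give ∑ F_c ≤ 4D + n + 2, at most 5n + 6 with equality only if D = n + 1.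
  -- Conversely 6D ≤ ∑ F_c + n.
  have h₁ : ∑ c, numCycles (G.wick * G.partner c) + 6 * numCycles G.wick ≤
      2 * ∑ c, finrank ℚ (linked G.wick (G.colored c)) + n := by
    have := Finset.sum_le_sum fun c (_ : c ∈ (Finset.univ : Finset (Fin 6))) =>
      numCycles_mul_flip_add_le G.wick (G.colored c)
    rw [Finset.sum_add_distrib, Finset.sum_add_distrib, sum_card_colored, ← Finset.mul_sum] at this
    simpa [partner_eq_flip] using this
  have h₂ := sum_finrank_linked_add_le G.wick Finset.univ G.colored
  have h₃ : Finset.univ.biUnion G.colored = Finset.univ := by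
    ext v
    simp [colored]
  rw [h₃, Finset.card_univ, Fintype.card_fin] at h₂
  have h₄ := h.finrank_le_one
  have h₅ := h.numCycles_le
  have h₆ : 6 * numCycles G.wick ≤ ∑ c, numCycles (G.wick * G.partner c) + n := by
    have := Finset.sum_le_sum fun c (_ : c ∈ (Finset.univ : Finset (Fin 6))) =>
      numCycles_le_mul_flip_add G.wick (G.colored c)
    rw [Finset.sum_add_distrib, sum_card_colored] at this
    simpa [partner_eq_flip] using this
  omega

/-! ### The degree -/

theorem numBicolored_eq (i j : Fin 7) :
    G.numBicolored i j = numCycles ((G.coloredEdge i)⁻¹ * G.coloredEdge j) :=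
  card_quotient_sameCycle _

theorem numBicolored_comm (i j : Fin 7) : G.numBicolored i j = G.numBicolored j i := by
  rw [numBicolored_eq, numBicolored_eq, ← numCycles_inv]
  simp

theorem numBicolored_zero_succ (c : Fin 6) :
    G.numBicolored 0 c.succ = numCycles (G.wick * G.partner c) := by
  rw [numBicolored_eq]
  rfl

/-- Two strand colours never meet the contractions, so these faces stay inside the vertices and
carry no information on `wick`. -/
theorem numBicolored_succ_succ {c c' : Fin 6} (h : c ≠ c') :
    G.numBicolored c.succ c'.succ + ((G.colored c).card + (G.colored c').card) = 2 * n := by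
  have h₁ : G.numBicolored c.succ c'.succ = numCycles ((G.partner c)⁻¹ * G.partner c') := by
    rw [numBicolored_eq]
    rfl
  rw [h₁, partner_eq_flip, partner_eq_flip, flip_inv, flip_mul_flip (G.disjoint_colored h),
    ← Finset.card_union_of_disjoint (G.disjoint_colored h), numCycles_flip]

theorem sum_numBicolored :
    ∑ i, ∑ j, (if i = j then 0 else (G.numBicolored i j : ℚ)) =
      2 * ∑ c, (numCycles (G.wick * G.partner c) : ℚ) + 50 * n := by
  have h₁ : ∑ c : Fin 6, ∑ c' : Fin 6,
      (if c = c' then 0 else (G.numBicolored c.succ c'.succ : ℚ)) = 50 * n := by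
    have h₂ : ∀ c c' : Fin 6, (if c = c' then 0 else (G.numBicolored c.succ c'.succ : ℚ)) =
        if c = c' then 0 else 2 * (n : ℚ) - (G.colored c).card - (G.colored c').card := by
      intro c c'
      split_ifs with h
      · rfl
      · have := G.numBicolored_succ_succ h
        have : (G.numBicolored c.succ c'.succ + ((G.colored c).card + (G.colored c').card) : ℚ) =
          2 * n := by exact_mod_cast this
        linarith
    simp_rw [h₂]
    -- Thirty ordered pairs give 60n, and each cardinality is subtracted ten times, whence 50n.
    have h₃ : ∑ c, ((G.colored c).card : ℚ) = n := by exact_mod_cast G.sum_card_colored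
    simp only [Fin.sum_univ_six] at h₃ ⊢
    simp only [Fin.reduceEq, if_false, if_true]
    linarith
  rw [Fin.sum_univ_succ]
  simp_rw [Fin.sum_univ_succ (n := 6), Fin.succ_inj]
  rw [Finset.sum_add_distrib, h₁]
  simp only [G.numBicolored_comm (Fin.succ _) 0, numBicolored_zero_succ, Fin.succ_ne_zero,
    (Fin.succ_ne_zero _).symm, if_false, if_true]
  ring

end FeynmanGraph

/-- The cyclic permutations of the seven colours. -/
noncomputable def jacketCycles : Finset (Perm (Fin 7)) :=
  open Classical in {ξ | ξ.IsCycle ∧ ξ.support = Finset.univ}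

theorem mem_jacketCycles {ξ : Perm (Fin 7)} :
    ξ ∈ jacketCycles ↔ ξ.IsCycle ∧ ξ.support = Finset.univ := by
  simp [jacketCycles]

/-- Conjugation by a permutation sending 0, 1 to `i`, `j` preserves the 7-cycles, so all ordered
pairs of distinct colours occur equally often in jackets. -/
theorem card_jacketCycles_apply {i j : Fin 7} (hij : i ≠ j) :
    (jacketCycles.filter fun ξ => ξ i = j).card = (jacketCycles.filter fun ξ => ξ 0 = 1).card := by
  obtain ⟨π, h0, h1⟩ : ∃ π : Perm (Fin 7), π 0 = i ∧ π 1 = j := by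
    refine ⟨swap 0 i * swap 1 (swap 0 i j), ?_, ?_⟩
    · rw [Perm.mul_apply, swap_apply_of_ne_of_ne (a := 1) (b := swap 0 i j) (x := 0)
        (by decide), swap_apply_left]
      intro h
      have : swap 0 i i = swap 0 i j := (swap_apply_right 0 i).trans h
      exact hij ((swap 0 i).injective this)
    · simp
  have hconj : ∀ (τ ξ : Perm (Fin 7)), ξ ∈ jacketCycles → τ * ξ * τ⁻¹ ∈ jacketCycles := by
    intro τ ξ hξ
    rw [mem_jacketCycles] at hξ ⊢
    refine ⟨hξ.1.conj, ?_⟩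
    rw [Perm.support_conj, hξ.2]
    simp
  refine Finset.card_bij' (fun ξ _ => π⁻¹ * ξ * π) (fun ξ _ => π * ξ * π⁻¹) ?_ ?_ ?_ ?_
  · intro ξ hξ
    rw [Finset.mem_filter] at hξ ⊢
    refine ⟨by simpa using hconj π⁻¹ ξ hξ.1, ?_⟩
    rw [Perm.mul_apply, Perm.mul_apply, h0, hξ.2, Perm.inv_eq_iff_eq, h1]
  · intro ξ hξ
    rw [Finset.mem_filter] at hξ ⊢
    refine ⟨hconj π ξ hξ.1, ?_⟩
    rw [Perm.mul_apply, Perm.mul_apply, Perm.inv_eq_iff_eq.2 h0.symm, hξ.2, h1]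
  · intro ξ _
    group
  · intro ξ _
    group

theorem card_jacketCycles_pos : 0 < (jacketCycles.filter fun ξ => ξ 0 = 1).card := by
  refine Finset.card_pos.2 ⟨finRotate 7, Finset.mem_filter.2 ⟨mem_jacketCycles.2 ⟨?_, ?_⟩, ?_⟩⟩
  · exact isCycle_finRotate
  · exact support_finRotate
  · decide

theorem sum_jacketCycles (F : Fin 7 → Fin 7 → ℚ) :
    ∑ ξ ∈ jacketCycles, ∑ i, F i (ξ i) =
      (jacketCycles.filter fun ξ => ξ 0 = 1).card * ∑ i, ∑ j, if i = j then 0 else F i j := by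
  rw [Finset.sum_comm, Finset.mul_sum]
  refine Finset.sum_congr rfl fun i _ => ?_
  rw [Finset.mul_sum, ← Finset.sum_fiberwise_of_maps_to (t := Finset.univ) (g := fun ξ => ξ i)
    (fun _ _ => Finset.mem_univ _)]
  refine Finset.sum_congr rfl fun j _ => ?_
  have h : ∑ ξ ∈ jacketCycles with ξ i = j, F i (ξ i) = ∑ ξ ∈ jacketCycles with ξ i = j, F i j :=
    Finset.sum_congr rfl fun ξ hξ => by rw [(Finset.mem_filter.1 hξ).2]
  rw [h, Finset.sum_const, nsmul_eq_mul]
  split_ifs with hij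
  · have : jacketCycles.filter (fun ξ => ξ i = j) = ∅ := by
      rw [Finset.filter_eq_empty_iff]
      intro ξ hξ hfix
      have hmem : i ∈ ξ.support := by
        rw [(mem_jacketCycles.1 hξ).2]
        exact Finset.mem_univ i
      exact Perm.mem_support.1 hmem (hfix.trans hij.symm)
    rw [this]
    simp
  · rw [card_jacketCycles_apply hij]

theorem card_jacketCycles :
    (jacketCycles.card : ℚ) = 6 * (jacketCycles.filter fun ξ => ξ 0 = 1).card := by
  -- This test function counts each 7-cycle once on the left, and the six possible images of 0 on
  -- the right.
  have h := sum_jacketCycles fun i _ => if i = 0 then 1 else 0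
  simp only [Finset.sum_ite_eq', Finset.mem_univ, if_true, Finset.sum_const, nsmul_eq_mul,
    mul_one] at h
  rw [h, Fin.sum_univ_seven]
  simp only [Fin.sum_univ_seven]
  simp only [Fin.reduceEq, if_false, if_true]
  norm_num
  ring

namespace FeynmanGraph

variable {n N : ℕ} (G : FeynmanGraph n N)

theorem degree_eq :
    G.degree = (jacketCycles.filter fun ξ => ξ 0 = 1).card / 2 *
      (6 + 5 * n - ∑ c, (numCycles (G.wick * G.partner c) : ℚ)) := by
  have h : G.degree = (∑ ξ ∈ jacketCycles, G.jacketGenus ξ) / 2 := rfl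
  simp only [h, jacketGenus]
  rw [Finset.sum_sub_distrib, ← Finset.sum_div, Finset.sum_add_distrib, sum_jacketCycles
    fun i j => (G.numBicolored i j : ℚ), sum_numBicolored]
  simp only [Finset.sum_const, nsmul_eq_mul, card_jacketCycles]
  ring

theorem isMelonic_iff (h : IsLinked G.wick) : G.IsMelonic ↔ numCycles G.wick = n + 1 := by
  rw [← G.sum_numCycles_eq_iff h, IsMelonic, degree_eq]
  have := card_jacketCycles_pos
  have hpos : ((jacketCycles.filter fun ξ => ξ 0 = 1).card / 2 : ℚ) ≠ 0 := by positivity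
  rw [mul_eq_zero, or_iff_right hpos, sub_eq_zero, eq_comm]
  norm_cast
  rw [add_comm]

end FeynmanGraph

end TGFT

namespace TGFT

open Equiv Module

/-! ### Dimension of the space of momentum fields on a connected set of disks -/

section Fields

variable {D : Type*}

/-- The fields of momenta of sum zero, whose component of colour `c` is constant along `E c`, and
that vanish on `X`. -/
def fieldSpace (E : Fin 6 → D → D → Prop) (X : Finset D) : Submodule ℚ (D → Fin 6 → ℚ) where
  carrier := {K | (∀ d, ∑ c, K d c = 0) ∧ (∀ c d d', E c d d' → K d c = K d' c) ∧
    ∀ d ∈ X, K d = 0}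
  add_mem' := by
    rintro K K' ⟨h₁, h₂, h₃⟩ ⟨h₁', h₂', h₃'⟩
    exact ⟨fun d => by simp [Finset.sum_add_distrib, h₁, h₁'],
      fun c d d' h => by simp [h₂ c d d' h, h₂' c d d' h],
      fun d hd => by simp [h₃ d hd, h₃' d hd]⟩
  zero_mem' := by simp
  smul_mem' := by
    rintro r K ⟨h₁, h₂, h₃⟩
    exact ⟨fun d => by simp [← Finset.mul_sum, h₁],
      fun c d d' h => by simp [h₂ c d d' h], fun d hd => by simp [h₃ d hd]⟩

variable [Fintype D] [DecidableEq D] {E : Fin 6 → D → D → Prop}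

/-- The value at `b` is all that is lost, and its components in `T` vanish because they are tied to
disks of `X`. -/
theorem finrank_fieldSpace_le_insert (X : Finset D) (b : D) {T : Finset (Fin 6)} {i : Fin 6}
    (hi : i ∉ T) (hT : ∀ c ∈ T, ∃ d ∈ X, E c d b) :
    finrank ℚ (fieldSpace E X) ≤ finrank ℚ (fieldSpace E (insert b X)) + (5 - T.card) := by
  refine (finrank_le_finrank_add_of_map (W' := fieldSpace E (insert b X))
    (LinearMap.proj (R := ℚ) (φ := fun _ : D => Fin 6 → ℚ) b) (gaugeSpace T) ?_ ?_).trans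
    (Nat.add_le_add_left (finrank_gaugeSpace_le hi) _)
  · rintro K ⟨h₁, h₂, h₃⟩
    refine ⟨h₁ b, fun c hc => ?_⟩
    obtain ⟨d, hd, hE⟩ := hT c hc
    simp [← h₂ c d b hE, h₃ d hd]
  · rintro K ⟨h₁, h₂, h₃⟩ h0
    refine ⟨h₁, h₂, fun d hd => ?_⟩
    rcases Finset.mem_insert.1 hd with rfl | hd
    exacts [h0, h₃ d hd]

theorem finrank_fieldSpace_le
    (hE : ∀ Y : Finset D, Y.Nonempty → Y ≠ Finset.univ → ∃ c, ∃ d ∈ Y, ∃ d' ∉ Y, E c d d')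
    (X : Finset D) (hX : X.Nonempty) :
    finrank ℚ (fieldSpace E X) + 4 * X.card ≤ 4 * Fintype.card D := by
  induction hk : Fintype.card D - X.card generalizing X with
  | zero =>
    have hX' : X = Finset.univ :=
      (Finset.card_eq_iff_eq_univ X).1 (le_antisymm (Finset.card_le_univ X) (by omega))
    have : fieldSpace E X = ⊥ := by
      rw [eq_bot_iff]
      rintro K ⟨-, -, h⟩
      exact funext fun d => h d (hX' ▸ Finset.mem_univ d)
    rw [this, finrank_bot, hX', Finset.card_univ, zero_add]
  | succ k ih =>
    have hX' : X ≠ Finset.univ := by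
      rintro rfl
      simp at hk
    obtain ⟨c, d, hd, d', hd', h⟩ := hE X hX hX'
    -- The colour `c + 1` serves only as one different from `c`.
    have h₁ := finrank_fieldSpace_le_insert X d' (T := {c}) (i := c + 1) (by simp)
      (by simpa using ⟨d, hd, h⟩)
    have h₂ := ih (insert d' X) (Finset.insert_nonempty _ _)
      (by rw [Finset.card_insert_of_notMem hd']; omega)
    rw [Finset.card_insert_of_notMem hd'] at h₂
    rw [Finset.card_singleton] at h₁
    omega

/-- Grow `Y` away from `b`. The first new disk linked to `b` is linked to `Y` by one colour and to
`b` by another, as equal colours would link `Y` to `b` by transitivity. That disk brings 3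
dimensions instead of 4. -/
theorem finrank_fieldSpace_lt
    (hE : ∀ Y : Finset D, Y.Nonempty → Y ≠ Finset.univ → ∃ c, ∃ d ∈ Y, ∃ d' ∉ Y, E c d d')
    (hequiv : ∀ c, Equivalence (E c)) (b : D) (Y : Finset D)
    (hY : Y.Nonempty) (hYb : ∀ d ∈ Y, ∀ c, ¬ E c d b) :
    finrank ℚ (fieldSpace E (insert b Y)) + 4 * (Y.card + 1) < 4 * Fintype.card D := by
  induction hk : Fintype.card D - Y.card generalizing Y with
  | zero =>
    have hY' : Y = Finset.univ :=
      (Finset.card_eq_iff_eq_univ Y).1 (le_antisymm (Finset.card_le_univ Y) (by omega))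
    exact (hYb b (hY' ▸ Finset.mem_univ b) 0 ((hequiv 0).refl b)).elim
  | succ k ih =>
    have hb : b ∉ Y := fun hb => hYb b hb 0 ((hequiv 0).refl b)
    obtain ⟨c, d, hd, d', hd', h⟩ := hE Y hY (fun hY' => hb (hY' ▸ Finset.mem_univ b))
    have hne : d' ≠ b := by
      rintro rfl
      exact hYb d hd c h
    have hins : d' ∉ insert b Y := by simp [hne, hd']
    by_cases hB : ∃ c', E c' d' b
    · obtain ⟨c', hc'⟩ := hB
      have hcc : c ≠ c' := by
        rintro rfl
        exact hYb d hd c ((hequiv c).trans h hc')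
      obtain ⟨i, hi⟩ : ∃ i, i ∉ ({c, c'} : Finset (Fin 6)) := by
        by_contra! hall
        have := Finset.card_le_card (fun i _ => hall i : Finset.univ ⊆ ({c, c'} : Finset (Fin 6)))
        rw [Finset.card_pair hcc] at this
        simp at this
      have h₁ := finrank_fieldSpace_le_insert (E := E) (insert b Y) d' hi (by
        intro a ha
        rcases Finset.mem_insert.1 ha with rfl | ha
        · exact ⟨d, Finset.mem_insert_of_mem hd, h⟩
        · rw [Finset.mem_singleton] at ha
          subst ha
          exact ⟨b, Finset.mem_insert_self _ _, (hequiv a).symm hc'⟩)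
      have h₂ := finrank_fieldSpace_le hE (insert d' (insert b Y)) (Finset.insert_nonempty _ _)
      rw [Finset.card_insert_of_notMem hins, Finset.card_insert_of_notMem hb] at h₂
      rw [Finset.card_pair hcc] at h₁
      omega
    · push Not at hB
      have h₁ := finrank_fieldSpace_le_insert (insert b Y) d' (T := {c}) (i := c + 1) (by simp)
        (by simpa using Or.inr ⟨d, hd, h⟩)
      have h₂ := ih (insert d' Y) (Finset.insert_nonempty _ _)
        (by
          intro e he a
          rcases Finset.mem_insert.1 he with rfl | he
          exacts [hB a, hYb e he a])
        (by rw [Finset.card_insert_of_notMem hd']; omega)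
      rw [Finset.card_insert_of_notMem hd', Finset.insert_comm] at h₂
      rw [Finset.card_singleton] at h₁
      omega

end Fields

/-! ### Power counting -/

namespace FeynmanGraph

variable {n N : ℕ} (G : FeynmanGraph n N)

/-- Gauge invariance forces the momentum to be constant along the disks, and a vertex only imposes
the equality of the components of its colour of the momenta of its two disks. -/
theorem wick_invariant_of_gauge {R : Type*} [AddCommGroup R] {K : Half n → Fin 6 → R}
    (hgauge : ∀ d, ∑ c, K d c = 0)
    (hstrand : ∀ d c, K (G.wick.symm d) c = K (G.partner c d) c) :
    (∀ d, K (G.wick d) = K d) ∧ ∀ d, K (d.1, !d.2) (G.color d.1) = K d (G.color d.1) := by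
  have key : ∀ d, K (G.wick.symm d) = K d := by
    intro d
    -- Five components pass straight through the half; the vanishing sums then force the sixth to
    -- agree.
    have hoff : ∀ c, c ≠ G.color d.1 → K (G.wick.symm d) c = K d c := by
      intro c hc
      rw [hstrand, partner_apply, if_neg hc.symm]
    ext c
    by_cases hc : c = G.color d.1
    · have h := (hgauge (G.wick.symm d)).trans (hgauge d).symm
      rw [← Finset.add_sum_erase _ _ (Finset.mem_univ c),
        ← Finset.add_sum_erase _ (K d) (Finset.mem_univ c),
        Finset.sum_congr rfl fun a ha => hoff a (hc ▸ Finset.ne_of_mem_erase ha)] at h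
      exact add_right_cancel h
    · exact hoff c hc
  refine ⟨fun d => ?_, fun d => ?_⟩
  · simpa using (key (G.wick d)).symm
  · have h := hstrand d (G.color d.1)
    rwa [key, partner_apply, if_pos rfl, eq_comm] at h

/-! ### Kernel of the incidence matrix -/

/-- The disks of the intermediate field representation. -/
abbrev Disk : Type := Quotient (Perm.SameCycle.setoid G.wick)

/-- The disk through `d`. -/
def diskOf (d : Half n) : G.Disk := Quotient.mk _ d

noncomputable instance : Fintype G.Disk := Fintype.ofFinite _

theorem card_disk : Fintype.card G.Disk = numCycles G.wick := by
  rw [← Nat.card_eq_fintype_card, card_quotient_sameCycle]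

theorem diskOf_eq {d d' : Half n} : G.diskOf d = G.diskOf d' ↔ G.wick.SameCycle d d' :=
  Quotient.eq

theorem diskOf_wick (d : Half n) : G.diskOf (G.wick d) = G.diskOf d :=
  G.diskOf_eq.2 (Perm.sameCycle_apply_left.2 (Perm.SameCycle.refl _ _))

/-- Two arcs are `c`-linked if their disks are joined by a path of wavy edges of colour `c`. -/
def MonoLinked (c : Fin 6) : Half n → Half n → Prop :=
  Relation.EqvGen fun d d' => G.wick.SameCycle d d' ∨ (G.color d.1 = c ∧ d' = (d.1, !d.2))

/-- Two disks are `c`-linked if they are joined by a path of wavy edges of colour `c`. -/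
def DiskLinked (c : Fin 6) (X Y : G.Disk) : Prop :=
  ∃ d d', G.diskOf d = X ∧ G.diskOf d' = Y ∧ G.MonoLinked c d d'

variable {G}

theorem MonoLinked.of_sameCycle {c : Fin 6} {d d' : Half n} (h : G.wick.SameCycle d d') :
    G.MonoLinked c d d' := Relation.EqvGen.rel _ _ (Or.inl h)

theorem MonoLinked.trans {c : Fin 6} {d d' d'' : Half n} (h : G.MonoLinked c d d')
    (h' : G.MonoLinked c d' d'') : G.MonoLinked c d d'' := Relation.EqvGen.trans _ _ _ h h'

theorem diskLinked_diskOf {c : Fin 6} {d d' : Half n} :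
    G.DiskLinked c (G.diskOf d) (G.diskOf d') ↔ G.MonoLinked c d d' := by
  constructor
  · rintro ⟨e, e', he, he', h⟩
    exact ((MonoLinked.of_sameCycle (G.diskOf_eq.1 he.symm)).trans h).trans
      (MonoLinked.of_sameCycle (G.diskOf_eq.1 he'))
  · exact fun h => ⟨d, d', rfl, rfl, h⟩

theorem diskOf_surjective : Function.Surjective G.diskOf := Quotient.mk_surjective

theorem diskLinked_equivalence (c : Fin 6) : Equivalence (G.DiskLinked c) where
  refl X := by
    obtain ⟨d, rfl⟩ := diskOf_surjective X
    exact diskLinked_diskOf.2 (Relation.EqvGen.refl d)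
  symm {X Y} h := by
    obtain ⟨d, d', rfl, rfl, h⟩ := h
    exact diskLinked_diskOf.2 (h.symm _ _)
  trans {X Y Z} h h' := by
    obtain ⟨d, rfl⟩ := diskOf_surjective X
    obtain ⟨d', rfl⟩ := diskOf_surjective Y
    obtain ⟨d'', rfl⟩ := diskOf_surjective Z
    rw [diskLinked_diskOf] at h h' ⊢
    exact h.trans h'

theorem MonoLinked.apply_eq {R : Type*} {K : Half n → Fin 6 → R}
    (hwick : ∀ d, K (G.wick d) = K d)
    (hcolor : ∀ d, K (d.1, !d.2) (G.color d.1) = K d (G.color d.1)) {c : Fin 6} {d d' : Half n}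
    (h : G.MonoLinked c d d') : K d c = K d' c := by
  induction h with
  | rel d d' h =>
    rcases h with h | ⟨rfl, rfl⟩
    · rw [apply_eq_of_sameCycle hwick h]
    · exact (hcolor d).symm
  | refl d => rfl
  | symm d d' _ ih => exact ih.symm
  | trans d d' d'' _ _ ih ih' => exact ih.trans ih'

/-- Otherwise the indicator function of `Y` would be a nonconstant linked function. -/
theorem exists_diskLinked_of_isLinked (h : IsLinked G.wick) (Y : Finset G.Disk)
    (hY : Y.Nonempty) (hY' : Y ≠ Finset.univ) :
    ∃ c, ∃ X ∈ Y, ∃ X' ∉ Y, G.DiskLinked c X X' := by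
  classical
  by_contra! hno
  have hφ : (fun d => if G.diskOf d ∈ Y then 1 else 0) ∈ linked G.wick Finset.univ := by
    refine ⟨fun d => by simp only [diskOf_wick], fun v _ => ?_⟩
    have h₁ : ∀ b, G.diskOf (v, b) ∈ Y → G.diskOf (v, !b) ∈ Y := by
      intro b hb
      by_contra hb'
      exact hno (G.color v) _ hb _ hb'
        (diskLinked_diskOf.2 (Relation.EqvGen.rel _ _ (Or.inr ⟨rfl, rfl⟩)))
    have h₂ : G.diskOf (v, false) ∈ Y ↔ G.diskOf (v, true) ∈ Y := ⟨h₁ false, h₁ true⟩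
    simp only [h₂]
  obtain ⟨X, hX⟩ := hY
  apply hY'
  rw [Finset.eq_univ_iff_forall]
  intro X'
  obtain ⟨d, rfl⟩ := diskOf_surjective X
  obtain ⟨d', rfl⟩ := diskOf_surjective X'
  have := h _ hφ d d'
  simp only [hX, if_true] at this
  by_contra hX'
  simp [hX'] at this

variable (G)

theorem faceOf_wick_symm (c : Fin 6) (d : Half n) :
    G.faceOf c (G.wick.symm d) = G.faceOf c (G.partner c d) := by
  refine Quotient.sound ?_
  have : G.partner c d = G.facePerm c (G.wick.symm d) := by simp [facePerm]
  rw [this]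
  exact Perm.sameCycle_apply_right.2 (Perm.SameCycle.refl _ _)

/-- The component of colour `c` of the momentum of the arc `d`, as a function of the momenta that
circulate in the internal faces. -/
noncomputable def faceMomentum (c : Fin 6) (d : Half n) : (G.InternalFace → ℚ) →ₗ[ℚ] ℚ :=
  open Classical in
  -- The default 0 is the right value on open faces: they are not columns of the incidence matrix,
  -- and it makes the field vanish on the cilia.
  if h : ∀ j, G.faceOf c (G.cilium j) ≠ G.faceOf c d then LinearMap.proj ⟨⟨c, G.faceOf c d⟩, h⟩
  else 0

theorem faceMomentum_congr {c : Fin 6} {d d' : Half n} (h : G.faceOf c d = G.faceOf c d') :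
    G.faceMomentum c d = G.faceMomentum c d' := by
  by_cases h' : ∀ j, G.faceOf c (G.cilium j) ≠ G.faceOf c d
  · rw [faceMomentum, faceMomentum, dif_pos h', dif_pos (h ▸ h')]
    simp only [h]
  · rw [faceMomentum, faceMomentum, dif_neg h', dif_neg (h ▸ h')]

theorem faceMomentum_cilium (c : Fin 6) (j : Fin N) : G.faceMomentum c (G.cilium j) = 0 :=
  dif_neg fun h => h j rfl

/-- Thus the kernel of the incidence matrix is the gauge constraint on all internal lines. -/
theorem sum_faceMomentum (l : G.Line) (x : G.InternalFace → ℚ) :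
    ∑ c, G.faceMomentum c l.1 x = (G.incidence.mulVec x) l := by
  classical
  rw [Matrix.mulVec, dotProduct, ← Finset.sum_fiberwise_of_maps_to (t := Finset.univ)
    (g := fun f : G.InternalFace => f.1.1) (fun _ _ => Finset.mem_univ _)]
  refine Finset.sum_congr rfl fun c _ => ?_
  by_cases h : ∀ j, G.faceOf c (G.cilium j) ≠ G.faceOf c l.1
  · rw [faceMomentum, dif_pos h, Finset.sum_eq_single ⟨⟨c, G.faceOf c l.1⟩, h⟩]
    · simp [incidence]
    · rintro ⟨⟨c', F⟩, hF⟩ hc hne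
      obtain rfl : c' = c := by simpa using hc
      have : G.faceOf c' l.1 ≠ F := by
        rintro rfl
        exact hne rfl
      simp [incidence, this]
    · intro hc
      simp at hc
  · rw [faceMomentum, dif_neg h, Finset.sum_eq_zero]
    · rfl
    · rintro ⟨⟨c', F⟩, hF⟩ hc
      obtain rfl : c' = c := by simpa using hc
      have : G.faceOf c' l.1 ≠ F := by
        rintro rfl
        exact h hF
      simp [incidence, this]

/-- The ciliated disks. -/
noncomputable def ciliated : Finset G.Disk :=
  open Classical in Finset.univ.image fun j => G.diskOf (G.cilium j)

theorem mem_ciliated {X : G.Disk} : X ∈ G.ciliated ↔ ∃ j, G.diskOf (G.cilium j) = X := by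
  simp [ciliated]

theorem card_ciliated : G.ciliated.card = N := by
  classical
  rw [ciliated, Finset.card_image_of_injective, Finset.card_univ, Fintype.card_fin]
  intro i j h
  exact G.eq_of_sameCycle i j (G.diskOf_eq.1 h)

theorem cilium_injective : Function.Injective G.cilium := by
  intro i j h
  exact G.eq_of_sameCycle i j (h ▸ Perm.SameCycle.refl _ _)

theorem card_line_add : Fintype.card G.Line + N = 2 * n := by
  classical
  have h := Fintype.card_subtype_compl fun d => d ∈ Set.range G.cilium
  have h₁ : Fintype.card {d // d ∈ Set.range G.cilium} = N := by
    rw [← Nat.card_eq_fintype_card]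
    exact (Nat.card_range_of_injective G.cilium_injective).trans (by simp)
  have h₂ := Fintype.card_subtype_le fun d => d ∈ Set.range G.cilium
  have h₃ : Fintype.card G.Line = Fintype.card {d // d ∉ Set.range G.cilium} :=
    Fintype.card_congr (Equiv.refl _)
  rw [h₁, Fintype.card_prod, Fintype.card_fin, Fintype.card_bool] at h₂ h
  omega

/-- Rank-nullity makes F - R the dimension of the kernel, which injects into the fields on the
disks; and L = 2n - N. -/
theorem divergenceDegree_le :
    G.divergenceDegree ≤ finrank ℚ (fieldSpace G.DiskLinked G.ciliated) -
      2 * (2 * (n : ℤ) - N) := by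
  have hker : finrank ℚ (LinearMap.ker G.incidence.mulVecLin) ≤
      finrank ℚ (⊥ : Submodule ℚ (G.InternalFace → ℚ)) +
        finrank ℚ (fieldSpace G.DiskLinked G.ciliated) := by
    have hprop : ∀ x ∈ LinearMap.ker G.incidence.mulVecLin,
        (∀ d, ∑ c, G.faceMomentum c d x = 0) ∧
        ((∀ d, (fun c => G.faceMomentum c (G.wick d) x) = fun c => G.faceMomentum c d x) ∧
          ∀ d : Half n, G.faceMomentum (G.color d.1) (d.1, !d.2) x =
            G.faceMomentum (G.color d.1) d x) := by
      intro x hx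
      have hgauge : ∀ d, ∑ c, G.faceMomentum c d x = 0 := by
        intro d
        by_cases hd : d ∈ Set.range G.cilium
        · obtain ⟨j, rfl⟩ := hd
          simp [faceMomentum_cilium]
        · exact (G.sum_faceMomentum ⟨d, hd⟩ x).trans (congrFun (LinearMap.mem_ker.1 hx) _)
      exact ⟨hgauge, G.wick_invariant_of_gauge (K := fun d c => G.faceMomentum c d x) hgauge
        fun d c => by rw [G.faceMomentum_congr (G.faceOf_wick_symm c d)]⟩
    have hout : ∀ x ∈ LinearMap.ker G.incidence.mulVecLin, ∀ d c,
        G.faceMomentum c (Quotient.out (G.diskOf d)) x = G.faceMomentum c d x := by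
      intro x hx d c
      have h : G.wick.SameCycle (Quotient.out (G.diskOf d)) d :=
        G.diskOf_eq.1 (Quotient.out_eq (G.diskOf d))
      exact congrFun (apply_eq_of_sameCycle (φ := fun d c => G.faceMomentum c d x)
        (hprop x hx).2.1 h) c
    refine finrank_le_finrank_add_of_map
      (LinearMap.pi fun X : G.Disk => LinearMap.pi fun c => G.faceMomentum c (Quotient.out X))
      _ ?_ ?_
    · intro x hx
      obtain ⟨h₁, h₂, h₃⟩ := hprop x hx
      refine ⟨fun X => h₁ _, ?_, ?_⟩
      · rintro c _ _ ⟨d, d', rfl, rfl, h⟩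
        simp only [LinearMap.pi_apply, hout x hx]
        exact MonoLinked.apply_eq (K := fun d c => G.faceMomentum c d x) h₂ h₃ h
      · intro X hX
        obtain ⟨j, rfl⟩ := G.mem_ciliated.1 hX
        ext c
        simp only [LinearMap.pi_apply, hout x hx, faceMomentum_cilium]
        rfl
    · intro x hx h0
      rw [Submodule.mem_bot]
      ext ⟨⟨c, F⟩, hF⟩
      obtain ⟨d, rfl⟩ := Quotient.mk_surjective F
      have h : G.faceMomentum c d x = 0 :=
        (hout x hx d c).symm.trans (congrFun (congrFun h0 (G.diskOf d)) c)
      have hF' : ∀ j, G.faceOf c (G.cilium j) ≠ G.faceOf c d := hF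
      rwa [faceMomentum, dif_pos hF'] at h
  have hrank := LinearMap.finrank_range_add_finrank_ker G.incidence.mulVecLin
  rw [finrank_fintype_fun_eq_card] at hrank
  have hline := G.card_line_add
  rw [finrank_bot, zero_add] at hker
  rw [divergenceDegree, Matrix.rank]
  omega

theorem divergenceDegree_le_of_isLinked (h : IsLinked G.wick) (hN : 1 ≤ N) :
    G.divergenceDegree ≤ 4 * ((numCycles G.wick : ℤ) - n) - 2 * N := by
  classical
  have h₁ := G.divergenceDegree_le
  have h₂ := finrank_fieldSpace_le (exists_diskLinked_of_isLinked h) G.ciliated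
    (Finset.card_pos.1 (by rw [card_ciliated]; omega))
  rw [card_ciliated, card_disk] at h₂
  omega

/-- Graphs with non-melonic closure are superficially convergent. -/
theorem divergenceDegree_neg_of_not_isMelonic (h : IsLinked G.wick) (hN : 1 ≤ N)
    (hG : ¬ G.IsMelonic) : G.divergenceDegree < 0 := by
  have h₁ := G.divergenceDegree_le_of_isLinked h hN
  have h₂ := h.numCycles_le
  have h₃ := (not_congr (G.isMelonic_iff h)).1 hG
  omega

theorem divergenceDegree_neg_of_three_le (h : IsLinked G.wick) (hN : 3 ≤ N) :
    G.divergenceDegree < 0 := by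
  have h₁ := G.divergenceDegree_le_of_isLinked h (by omega)
  have h₂ := h.numCycles_le
  omega

/-- The general bound only gives ω ≤ 0 for a tree with N = 2; the dimension saved at a two-coloured
junction makes it strict. -/
theorem divergenceDegree_neg_of_not_isMono (G : FeynmanGraph n 2) (h : IsLinked G.wick)
    (hG : ∀ c, ¬ G.IsMono c) : G.divergenceDegree < 0 := by
  classical
  have h₁ := G.divergenceDegree_le
  have h₂ := finrank_fieldSpace_lt (exists_diskLinked_of_isLinked h) diskLinked_equivalence
    (G.diskOf (G.cilium 1)) {G.diskOf (G.cilium 0)} (Finset.singleton_nonempty _)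
    (by
      intro X hX c hc
      rw [Finset.mem_singleton.1 hX, diskLinked_diskOf] at hc
      exact hG c hc)
  have h₃ : G.ciliated = insert (G.diskOf (G.cilium 1)) {G.diskOf (G.cilium 0)} := by
    ext X
    simp only [mem_ciliated, Fin.exists_fin_two, Finset.mem_insert, Finset.mem_singleton]
    rw [or_comm, eq_comm, eq_comm (b := X)]
  have h₄ := h.numCycles_le
  rw [← h₃, card_disk, Finset.card_singleton] at h₂
  push_cast at h₁
  omega

end FeynmanGraph

end TGFT

namespace TGFT

open Equiv Module

namespace FeynmanGraph

variable {n N : ℕ} {G : FeynmanGraph n N}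

/-! ### One-particle irreducible trees -/

/-- A linked function depends only on the vertex. Since `w` may differ from `G.wick` off `S`, the
lemma also covers the permutation obtained by cutting out a line. -/
theorem isLinked_of_connected {S : Set (Half n)} {w : Perm (Half n)}
    (hw : ∀ d ∈ S, w d = G.wick d) (h : (G.vertexGraph S).Connected) : IsLinked w := by
  rintro φ ⟨hφ, hφ'⟩
  have hψ : ∀ d : Half n, φ d = φ (d.1, false) := by
    rintro ⟨v, b⟩
    cases b
    · rfl
    · exact (hφ' v (Finset.mem_univ v)).symm
  have hstep : ∀ d ∈ S, φ (d.1, false) = φ ((G.wick d).1, false) := by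
    intro d hd
    rw [← hψ, ← hψ, ← hw d hd, hφ]
  have hadj : ∀ v u, (G.vertexGraph S).Adj v u → φ (v, false) = φ (u, false) := by
    intro v u hvu
    rw [vertexGraph, SimpleGraph.fromRel_adj] at hvu
    rcases hvu.2 with ⟨d, hd, rfl, rfl⟩ | ⟨d, hd, rfl, rfl⟩
    exacts [hstep d hd, (hstep d hd).symm]
  intro d d'
  have hwalk : ∀ v u, (G.vertexGraph S).Walk v u → φ (v, false) = φ (u, false) := by
    intro v u p
    induction p with
    | nil => rfl
    | cons hvu _ ih => exact (hadj _ _ hvu).trans ih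
  obtain ⟨p⟩ := h.preconnected d.1 d'.1
  rw [hψ d, hψ d', hwalk _ _ p]

theorem IsOnePI.isLinked (h : G.IsOnePI) : IsLinked G.wick :=
  isLinked_of_connected (fun _ _ => rfl) h.1

/-- In a one-particle irreducible melonic graph the ciliated disks are leaves of the tree. -/
theorem IsOnePI.wick_cilium (h : G.IsOnePI) (hG : G.IsMelonic) (j : Fin N) :
    G.wick (G.cilium j) = G.cilium j := by
  rw [isMelonic_iff G h.isLinked] at hG
  by_contra hne
  set d := G.wick (G.cilium j) with hd
  have hrange : d ∉ Set.range G.cilium := by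
    rintro ⟨i, hi⟩
    have : j = i := G.eq_of_sameCycle j i
      (by rw [hi, hd]; exact Perm.sameCycle_apply_right.2 (Perm.SameCycle.refl _ _))
    exact hne (by rw [← hi, this])
  -- The swap detaches `d` as a disk of its own and alters only the arcs `d` and `cilium j`, neither
  -- of which is used once the line `d` is removed. So the result is still linked, yet has n + 2
  -- disks.
  have hlinked : IsLinked (G.wick * swap d (G.cilium j)) := by
    refine isLinked_of_connected ?_ (h.2 d hrange)
    rintro e ⟨he, hed⟩
    rw [Perm.mul_apply, swap_apply_of_ne_of_ne hed]
    rintro rfl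
    exact he ⟨j, rfl⟩
  have h₁ := hlinked.numCycles_le
  have h₂ := numCycles_mul_swap_of_isFixed (σ := G.wick * swap d (G.cilium j)) (x := d)
    (y := G.cilium j) (by rw [Perm.mul_apply, swap_apply_left]) hne
  rw [mul_assoc, swap_mul_self, mul_one] at h₂
  omega

/-- If the only edge at the leaf `d` had another colour, `d` would be alone in its class. -/
theorem MonoLinked.color_eq {c : Fin 6} {d d' : Half n} (h : G.MonoLinked c d d') (hne : d ≠ d')
    (hd : G.wick d = d) : G.color d.1 = c := by
  by_contra hc
  have key : ∀ e e', G.MonoLinked c e e' → (e = d ↔ e' = d) := by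
    intro e e' h
    induction h with
    | rel e e' h =>
      rcases h with h | ⟨h', rfl⟩
      · have hfix : ∀ {e e'}, G.wick.SameCycle e e' → e = d → e' = d := by
          intro e e' hs he
          subst he
          exact (hs.eq_of_left hd).symm
        exact ⟨hfix h, hfix h.symm⟩
      · constructor
        · rintro rfl
          exact (hc h').elim
        · rintro rfl
          exact (hc h').elim
    | refl e => exact Iff.rfl
    | symm e e' _ ih => exact ih.symm
    | trans e e' e'' _ _ ih ih' => exact ih.trans ih'
  exact hne ((key d d' h).1 rfl).symm

theorem IsOnePI.color_cilium {G : FeynmanGraph n 2} (h : G.IsOnePI) (hG : G.IsMelonic)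
    {c : Fin 6} (hc : G.IsMono c) (j : Fin 2) : G.color (G.cilium j).1 = c := by
  have hne : G.cilium 0 ≠ G.cilium 1 := fun h => by simpa using G.cilium_injective h
  have h0 : G.MonoLinked c (G.cilium 0) (G.cilium 1) := hc
  fin_cases j
  · exact h0.color_eq hne (h.wick_cilium hG 0)
  · exact MonoLinked.color_eq (Relation.EqvGen.symm _ _ h0) hne.symm (h.wick_cilium hG 1)

end FeynmanGraph

/-! ### Amplitudes -/

section Propagator

variable {m M : ℝ} {ρ : ℕ}

theorem propagator_nonneg (m M : ℝ) (ρ : ℕ) (p : Momentum) : 0 ≤ propagator m M ρ p := by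
  rw [propagator]
  split_ifs
  · exact one_div_nonneg.2 (add_nonneg (Finset.sum_nonneg fun _ _ => sq_nonneg _) (sq_nonneg _))
  · exact le_rfl

theorem of_propagator_ne_zero {p : Momentum} (h : propagator m M ρ p ≠ 0) :
    ∑ c, p c = 0 ∧ ∑ c, (p c : ℝ) ^ 2 ≤ M ^ (2 * ρ) := by
  rw [propagator] at h
  by_contra h'
  exact h (if_neg h')

theorem propagator_comp (π : Perm (Fin 6)) (p : Momentum) :
    propagator m M ρ (fun c => p (π c)) = propagator m M ρ p := by
  rw [propagator, propagator, Equiv.sum_comp π p, Equiv.sum_comp π fun c => (p c : ℝ) ^ 2]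

theorem finite_momenta (B : ℝ) : {p : Momentum | ∑ c, (p c : ℝ) ^ 2 ≤ B}.Finite := by
  refine (Set.Finite.pi' fun _ : Fin 6 => Set.finite_Icc (-⌊B⌋) ⌊B⌋).subset fun p hp c => ?_
  have h₁ : (p c : ℝ) ^ 2 ≤ B :=
    (Finset.single_le_sum (fun c _ => sq_nonneg (p c : ℝ)) (Finset.mem_univ c)).trans hp
  have h₂ : |p c| ≤ p c ^ 2 := by
    rw [← sq_abs]
    exact Int.le_self_sq _
  have h₃ : |p c| ≤ ⌊B⌋ := by
    rw [Int.le_floor]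
    exact (by exact_mod_cast h₂ : ((|p c| : ℤ) : ℝ) ≤ (p c : ℝ) ^ 2).trans h₁
  exact abs_le.1 h₃

end Propagator

namespace FeynmanGraph

variable {n N : ℕ} (G : FeynmanGraph n N) (m M : ℝ) (ρ : ℕ)

/-- The contribution to the amplitude of an attribution of momenta to the arcs. -/
noncomputable def summand (p : Fin N → GaugeMomentum) (K : Half n → Momentum) : ℝ :=
  open Classical in
  if (∀ j, K (G.cilium j) = (p j).1) ∧
      (∀ d c, K (G.wick.symm d) c = K (G.partner c d) c) then
    ∏ l : G.Line, propagator m M ρ (K l.1)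
  else 0

theorem amplitude_eq_tsum (p : Fin N → GaugeMomentum) :
    G.amplitude m M ρ p = ∑' K, G.summand m M ρ p K := rfl

variable {m M ρ} {G}

theorem summand_of_ne_zero {p : Fin N → GaugeMomentum} {K : Half n → Momentum}
    (h : G.summand m M ρ p K ≠ 0) :
    (∀ j, K (G.cilium j) = (p j).1) ∧ (∀ d c, K (G.wick.symm d) c = K (G.partner c d) c) ∧
      ∀ l : G.Line, propagator m M ρ (K l.1) ≠ 0 := by
  classical
  rw [summand] at h
  split_ifs at h with hK
  · exact ⟨hK.1, hK.2, fun l hl => h (Finset.prod_eq_zero (Finset.mem_univ l) hl)⟩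
  · exact (h rfl).elim

theorem gauge_of_summand_ne_zero {p : Fin N → GaugeMomentum} {K : Half n → Momentum}
    (h : G.summand m M ρ p K ≠ 0) (d : Half n) : ∑ c, K d c = 0 := by
  obtain ⟨h₁, -, h₃⟩ := summand_of_ne_zero h
  by_cases hd : d ∈ Set.range G.cilium
  · obtain ⟨j, rfl⟩ := hd
    rw [h₁ j]
    exact (p j).2
  · exact (of_propagator_ne_zero (h₃ ⟨d, hd⟩)).1

variable (m M ρ G)

theorem summand_nonneg (p : Fin N → GaugeMomentum) (K : Half n → Momentum) :
    0 ≤ G.summand m M ρ p K := by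
  rw [summand]
  split_ifs
  · exact Finset.prod_nonneg fun l _ => propagator_nonneg m M ρ _
  · exact le_rfl

/-- Cut arcs have prescribed momenta and the cutoff bounds the others. Hence the `tsum` is a true
finite sum and not the default 0. -/
theorem finite_support_summand (p : Fin N → GaugeMomentum) :
    (Function.support (G.summand m M ρ p)).Finite := by
  refine (Set.Finite.pi' fun _ : Half n => (Set.finite_range fun j => (p j).1).union
    (finite_momenta (M ^ (2 * ρ)))).subset fun K hK d => ?_
  obtain ⟨h₁, -, h₃⟩ := summand_of_ne_zero hK
  by_cases hd : d ∈ Set.range G.cilium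
  · obtain ⟨j, rfl⟩ := hd
    exact Or.inl ⟨j, (h₁ j).symm⟩
  · exact Or.inr (of_propagator_ne_zero (h₃ ⟨d, hd⟩)).2

theorem amplitude_nonneg (p : Fin N → GaugeMomentum) : 0 ≤ G.amplitude m M ρ p :=
  tsum_nonneg fun K => G.summand_nonneg m M ρ p K

theorem sum_summand_le_amplitude (p : Fin N → GaugeMomentum) (T : Finset (Half n → Momentum)) :
    ∑ K ∈ T, G.summand m M ρ p K ≤ G.amplitude m M ρ p :=
  (summable_of_hasFiniteSupport (G.finite_support_summand m M ρ p)).sum_le_tsum T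
    fun K _ => G.summand_nonneg m M ρ p K

variable {G}

theorem MonoLinked.amplitude_eq_zero {c : Fin 6} {i j : Fin N}
    (h : G.MonoLinked c (G.cilium i) (G.cilium j)) {p : Fin N → GaugeMomentum}
    (hp : (p i).1 c ≠ (p j).1 c) : G.amplitude m M ρ p = 0 := by
  rw [amplitude_eq_tsum]
  convert tsum_zero with K
  by_contra hK
  obtain ⟨h₁, h₂, -⟩ := summand_of_ne_zero hK
  obtain ⟨h₃, h₄⟩ := G.wick_invariant_of_gauge (gauge_of_summand_ne_zero hK) h₂
  apply hp
  rw [← h₁, ← h₁]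
  exact h.apply_eq h₃ h₄

/-- If the ciliated disks are leaves, then the amplitude depends only on the components of the
external momenta of the colours of their edges. -/
theorem amplitude_eq_of_wick_cilium (hG : ∀ j, G.wick (G.cilium j) = G.cilium j)
    {p p' : Fin N → GaugeMomentum}
    (hp : ∀ j, (p j).1 (G.color (G.cilium j).1) = (p' j).1 (G.color (G.cilium j).1)) :
    G.amplitude m M ρ p = G.amplitude m M ρ p' := by
  classical
  -- Translation by `Δ` changes the momenta of the cut arcs only. It respects the strands: at a leaf
  -- the other five return to the same cilium, and `Δ` vanishes in the colour of the edge.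
  let Δ : Half n → Momentum := fun d => ∑ j, if G.cilium j = d then (p' j).1 - (p j).1 else 0
  have hcil : ∀ j, Δ (G.cilium j) = (p' j).1 - (p j).1 := by
    intro j
    simp only [Δ, G.cilium_injective.eq_iff, Finset.sum_ite_eq', Finset.mem_univ, if_true]
  have hline : ∀ d, d ∉ Set.range G.cilium → Δ d = 0 := by
    intro d hd
    exact Finset.sum_eq_zero fun j _ => if_neg fun h => hd ⟨j, h⟩
  have hwick : ∀ d, Δ (G.wick.symm d) = Δ d := by
    intro d
    by_cases hd : d ∈ Set.range G.cilium
    · obtain ⟨j, rfl⟩ := hd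
      rw [G.wick.symm_apply_eq.2 (hG j).symm]
    · rw [hline d hd, hline]
      rintro ⟨j, hj⟩
      refine hd ⟨j, ?_⟩
      rw [← hG j, hj, apply_symm_apply]
  have hcolor : ∀ d, Δ d (G.color d.1) = 0 := by
    intro d
    by_cases hd : d ∈ Set.range G.cilium
    · obtain ⟨j, rfl⟩ := hd
      rw [hcil, Pi.sub_apply, hp, sub_self]
    · rw [hline d hd, Pi.zero_apply]
  have hpartner : ∀ d c, Δ (G.wick.symm d) c = Δ (G.partner c d) c := by
    intro d c
    rw [hwick, partner_apply]
    split_ifs with h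
    · subst h
      rw [hcolor, hcolor (d.1, !d.2)]
    · rfl
  rw [amplitude_eq_tsum, amplitude_eq_tsum, ← (Equiv.addRight Δ).tsum_eq (G.summand m M ρ p')]
  refine tsum_congr fun K => ?_
  have hadd : Equiv.addRight Δ K = K + Δ := rfl
  rw [summand, summand]
  have h₁ : (∀ j, (Equiv.addRight Δ K) (G.cilium j) = (p' j).1) ↔
      ∀ j, K (G.cilium j) = (p j).1 := by
    refine forall_congr' fun j => ?_
    rw [hadd, Pi.add_apply, hcil, ← add_sub_assoc, sub_eq_iff_eq_add, add_comm,
      add_right_inj]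
  have h₂ : (∀ d c, (Equiv.addRight Δ K) (G.wick.symm d) c =
      (Equiv.addRight Δ K) (G.partner c d) c) ↔
      ∀ d c, K (G.wick.symm d) c = K (G.partner c d) c := by
    refine forall_congr' fun d => forall_congr' fun c => ?_
    rw [hadd, Pi.add_apply, Pi.add_apply, Pi.add_apply, Pi.add_apply, hpartner,
      add_left_inj]
  have h₃ : ∀ l : G.Line, (Equiv.addRight Δ K) l.1 = K l.1 := by
    intro l
    rw [hadd, Pi.add_apply, hline l.1 l.2, add_zero]
  simp only [h₁, h₂, h₃]

/-! ### Permutations of the colours -/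

/-- The permutations of the colours act on the graphs. -/
def recolor (π : Perm (Fin 6)) : FeynmanGraph n N ≃ FeynmanGraph n N where
  toFun G := { G with color := fun v => π (G.color v) }
  invFun G := { G with color := fun v => π.symm (G.color v) }
  left_inv G := by ext1 <;> simp
  right_inv G := by ext1 <;> simp

theorem recolor_color (π : Perm (Fin 6)) (v : Fin n) : (recolor π G).color v = π (G.color v) := rfl

theorem recolor_isOnePI (π : Perm (Fin 6)) : (recolor π G).IsOnePI ↔ G.IsOnePI := Iff.rfl

/-- Melonicity is a count of the cycles of `wick`, which recolouring leaves alone. -/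
theorem recolor_isMelonic (h : G.IsOnePI) (π : Perm (Fin 6)) :
    (recolor π G).IsMelonic ↔ G.IsMelonic :=
  (isMelonic_iff (recolor π G) h.isLinked).trans (isMelonic_iff G h.isLinked).symm

theorem recolor_isMono {G : FeynmanGraph n 2} (π : Perm (Fin 6)) (c : Fin 6) :
    (recolor π G).IsMono (π c) ↔ G.IsMono c := by
  simp only [IsMono, recolor_color, π.injective.eq_iff]
  rfl

theorem partner_recolor (π : Perm (Fin 6)) (c : Fin 6) :
    (recolor π G).partner (π c) = G.partner c := by
  apply Equiv.ext
  intro d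
  simp [partner_apply, recolor_color]

theorem amplitude_recolor (π : Perm (Fin 6)) {p p' : Fin N → GaugeMomentum}
    (hp : ∀ j c, (p' j).1 (π c) = (p j).1 c) :
    (recolor π G).amplitude m M ρ p' = G.amplitude m M ρ p := by
  classical
  let e : (Half n → Momentum) ≃ (Half n → Momentum) :=
    Equiv.piCongrRight fun _ => Equiv.arrowCongr π (Equiv.refl ℤ)
  have he : ∀ K d c, e K d (π c) = K d c := by
    intro K d c
    simp [e]
  rw [amplitude_eq_tsum, amplitude_eq_tsum, ← e.tsum_eq ((recolor π G).summand m M ρ p')]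
  refine tsum_congr fun K => ?_
  rw [summand, summand]
  have h₁ : (∀ j, e K ((recolor π G).cilium j) = (p' j).1) ↔
      ∀ j, K (G.cilium j) = (p j).1 := by
    refine forall_congr' fun j => ?_
    rw [funext_iff, funext_iff, ← π.forall_congr_right]
    simp only [he, hp]
    rfl
  have h₂ : (∀ d c, e K ((recolor π G).wick.symm d) c = e K ((recolor π G).partner c d) c) ↔
      ∀ d c, K (G.wick.symm d) c = K (G.partner c d) c := by
    refine forall_congr' fun d => ?_
    rw [← π.forall_congr_right]
    simp only [he, partner_recolor]
    rfl
  have h₃ : ∏ l : (recolor π G).Line, propagator m M ρ (e K l.1) =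
      ∏ l : G.Line, propagator m M ρ (K l.1) := by
    refine Fintype.prod_equiv (Equiv.refl _) _ _ fun l => ?_
    exact propagator_comp π.symm (K l.1)
  simp only [h₁, h₂, h₃]

end FeynmanGraph

/-- A gauge invariant momentum whose component of colour `0` is `q`. -/
def momentumOf (q : ℤ) : GaugeMomentum :=
  ⟨![q, -q, 0, 0, 0, 0], by simp [Fin.sum_univ_six]⟩

theorem momentumOf_zero (q : ℤ) : (momentumOf q).1 0 = q := rfl

/-- A permutation of the colours as an action on the momenta. -/
def permute (π : Perm (Fin 6)) (p : GaugeMomentum) : GaugeMomentum :=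
  ⟨fun c => p.1 (π.symm c), (Equiv.sum_comp π.symm p.1).trans p.2⟩

namespace FeynmanGraph

variable {n N : ℕ} {G : FeynmanGraph n N} (m M : ℝ) (ρ : ℕ)

/-- Move the colour `c` to 0, then replace the external momenta by any others with the same
component there, as the ciliated disks are leaves. -/
theorem IsOnePI.amplitude_eq (h : G.IsOnePI) (hG : G.IsMelonic) {c : Fin 6}
    (hc : ∀ j, G.color (G.cilium j).1 = c) {p : Fin N → GaugeMomentum} {q : ℤ}
    (hp : ∀ j, (p j).1 c = q) :
    G.amplitude m M ρ p = (recolor (swap c 0) G).amplitude m M ρ fun _ => momentumOf q := by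
  rw [← amplitude_recolor m M ρ (swap c 0) (p' := fun j => permute (swap c 0) (p j))
    (by simp [permute])]
  refine amplitude_eq_of_wick_cilium (G := recolor (swap c 0) G) m M ρ (h.wick_cilium hG)
    fun j => ?_
  have hj : (recolor (swap c 0) G).color ((recolor (swap c 0) G).cilium j).1 = 0 := by
    rw [recolor_color]
    exact (congrArg (swap c 0) (hc j)).trans (swap_apply_left c 0)
  rw [hj, momentumOf_zero]
  simp [permute, hp]

end FeynmanGraph

end TGFT

namespace TGFT

open Equiv Module Filter

/-! ### Star-shaped trees -/

section Star

variable {k N : ℕ} (hN : N ≤ k + 1)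

/-- The tree in which a disk with `k + 1` halves is surrounded by `k + 1` leaves, `N` of which are
ciliated, all the wavy edges having the colour `0`. -/
def star : FeynmanGraph (k + 1) N where
  color _ := 0
  wick :=
    { toFun := fun d => if d.2 then d else (d.1 + 1, false)
      invFun := fun d => if d.2 then d else (d.1 - 1, false)
      left_inv := by rintro ⟨v, b⟩; cases b <;> simp
      right_inv := by rintro ⟨v, b⟩; cases b <;> simp }
  cilium j := (Fin.castLE hN j, true)
  eq_of_sameCycle := by
    intro i j h
    have := congrArg Prod.fst (h.eq_of_left rfl)
    exact Fin.castLE_injective hN this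

theorem star_cilium (j : Fin N) : (star hN).cilium j = (Fin.castLE hN j, true) := rfl

theorem star_wick_true (v : Fin (k + 1)) : (star hN).wick (v, true) = (v, true) := rfl

theorem star_wick_false (v : Fin (k + 1)) : (star hN).wick (v, false) = (v + 1, false) := rfl

open scoped Fin.CommRing in
-- The central disk visits all vertices cyclically; without the arc at `u` there remains a path
-- starting at `u + 1`.
theorem star_vertexGraph_connected {S : Set (Half (k + 1))} (u : Fin (k + 1))
    (hS : ∀ v, v ≠ u → (v, false) ∈ S) : ((star hN).vertexGraph S).Connected := by
  have key : ∀ i : ℕ, i ≤ k →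
      ((star hN).vertexGraph S).Reachable (u + 1) (u + 1 + (i : Fin (k + 1))) := by
    intro i
    induction i with
    | zero => intro _; simp
    | succ i ih =>
      intro hi
      refine (ih (by omega)).trans ?_
      have hne : u + 1 + (i : Fin (k + 1)) ≠ u := by
        intro h
        rw [add_assoc, add_eq_left] at h
        have h' : ((i + 1 : ℕ) : Fin (k + 1)) = 0 := by
          push_cast
          exact (add_comm _ _).trans h
        rw [Fin.natCast_eq_zero] at h'
        exact absurd (Nat.le_of_dvd (by omega) h') (by omega)
      by_cases heq : u + 1 + (i : Fin (k + 1)) = u + 1 + ((i + 1 : ℕ) : Fin (k + 1))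
      · rw [← heq]
      · refine SimpleGraph.Adj.reachable ?_
        rw [FeynmanGraph.vertexGraph, SimpleGraph.fromRel_adj]
        refine ⟨heq, Or.inl ⟨_, hS _ hne, rfl, ?_⟩⟩
        rw [star_wick_false]
        push_cast
        exact add_assoc _ _ _
  have key' : ∀ v, ((star hN).vertexGraph S).Reachable (u + 1) v := by
    intro v
    have := key (v - (u + 1)).val (Nat.lt_succ_iff.1 (v - (u + 1)).isLt)
    rwa [Fin.cast_val_eq_self, add_sub_cancel] at this
  exact ⟨fun v w => (key' v).symm.trans (key' w)⟩

theorem notMem_range_star_cilium (v : Fin (k + 1)) :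
    (v, false) ∉ Set.range (star hN).cilium := by
  rintro ⟨j, hj⟩
  simp [star_cilium] at hj

theorem star_isOnePI : (star hN).IsOnePI := by
  refine ⟨star_vertexGraph_connected hN 0 fun v _ => notMem_range_star_cilium hN v,
    fun l _ => star_vertexGraph_connected hN l.1 fun v hv =>
      ⟨notMem_range_star_cilium hN v, ?_⟩⟩
  rintro rfl
  exact hv rfl

theorem star_isMelonic : (star hN).IsMelonic := by
  have h := (star_isOnePI hN).isLinked
  rw [FeynmanGraph.isMelonic_iff _ h]
  refine le_antisymm h.numCycles_le ?_
  rw [← FeynmanGraph.card_disk]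
  -- The k + 2 disks: `none` is the centre, `some v` a leaf.
  have hinj : Function.Injective fun o : Option (Fin (k + 1)) =>
      (star hN).diskOf (o.elim (0, false) fun v => (v, true)) := by
    intro o o' h
    rw [FeynmanGraph.diskOf_eq] at h
    cases o with
    | none =>
      cases o' with
      | none => rfl
      | some v => simpa using h.symm.eq_of_left rfl
    | some v =>
      have := h.eq_of_left rfl
      cases o' with
      | none => simp at this
      | some v' => simpa using this
  simpa using Fintype.card_le_of_injective _ hinj

theorem star_isMono {k : ℕ} (hk : 2 ≤ k + 1) : (star hk).IsMono 0 := by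
  have hedge : ∀ v, (star hk).MonoLinked 0 (v, true) (v, false) := fun v =>
    Relation.EqvGen.rel _ _ (Or.inr ⟨rfl, rfl⟩)
  have h1 : Fin.castLE hk 0 + 1 = Fin.castLE hk 1 := by
    ext
    rw [Fin.val_add, Fin.val_castLE, Fin.val_castLE]
    have : ((1 : Fin (k + 1)) : ℕ) = 1 := by
      rw [Fin.val_one', Nat.mod_eq_of_lt hk]
    rw [this, Nat.mod_eq_of_lt (by simpa using Nat.lt_of_succ_lt_succ hk)]
    rfl
  have hcycle : (star hk).wick.SameCycle (Fin.castLE hk 0, false) (Fin.castLE hk 1, false) := by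
    rw [← h1, ← star_wick_false hk]
    exact Perm.sameCycle_apply_right.2 (Perm.SameCycle.refl _ _)
  exact ((hedge _).trans (FeynmanGraph.MonoLinked.of_sameCycle hcycle)).trans
    (Relation.EqvGen.symm _ _ (hedge _))

theorem star_summand (m M : ℝ) (ρ : ℕ) {p : Fin N → GaugeMomentum}
    {K : Half (k + 1) → Momentum} (hcil : ∀ j, K (Fin.castLE hN j, true) = (p j).1)
    (hwick : ∀ v, K (v + 1, false) = K (v, false)) (hcolor : ∀ v, K (v, true) 0 = K (v, false) 0) :
    (star hN).summand m M ρ p K = ∏ l : (star hN).Line, propagator m M ρ (K l.1) := by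
  refine if_pos ⟨hcil, ?_⟩
  have h : ∀ d, K ((star hN).wick.symm d) = K d := by
    intro d
    obtain ⟨⟨v, b⟩, rfl⟩ := (star hN).wick.surjective d
    rw [symm_apply_apply]
    cases b
    · rw [star_wick_false, hwick]
    · rw [star_wick_true]
  rintro ⟨v, b⟩ c
  rw [h, FeynmanGraph.partner_apply]
  split_ifs with hc
  · obtain rfl : 0 = c := hc
    cases b
    exacts [(hcolor v).symm, hcolor v]
  · rfl

end Star

/-! ### Divergences -/

/-- The propagator without cutoff. -/
noncomputable def bareWeight (m : ℝ) (p : Momentum) : ℝ := 1 / (∑ c, (p c : ℝ) ^ 2 + m ^ 2)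

section Divergences

variable {m M : ℝ}

theorem bareWeight_pos (hm : 0 < m) (p : Momentum) : 0 < bareWeight m p :=
  one_div_pos.2 (add_pos_of_nonneg_of_pos (Finset.sum_nonneg fun _ _ => sq_nonneg _)
    (pow_pos hm 2))

theorem mul_bareWeight_le_one (hm : 0 < m) (p : Momentum) : m ^ 2 * bareWeight m p ≤ 1 := by
  have h : 0 ≤ ∑ c, (p c : ℝ) ^ 2 := Finset.sum_nonneg fun _ _ => sq_nonneg _
  have h' := pow_pos hm 2
  rw [bareWeight, mul_one_div, div_le_one (by linarith)]
  linarith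

theorem eventually_propagator_eq (hM : 1 < M) {p : Momentum} (hp : ∑ c, p c = 0) :
    ∀ᶠ ρ in atTop, propagator m M ρ p = bareWeight m p := by
  have h : Tendsto (fun ρ : ℕ => M ^ (2 * ρ)) atTop atTop := by
    simp_rw [pow_mul]
    exact tendsto_pow_atTop_atTop_of_one_lt (one_lt_pow₀ hM two_ne_zero)
  filter_upwards [h.eventually_ge_atTop (∑ c, (p c : ℝ) ^ 2)] with ρ hρ
  rw [propagator, if_pos ⟨hp, hρ⟩, bareWeight]

/-- Momenta of component `x` of colour `0`, given by four free components. -/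
def latticeMomentum (x : ℤ) (a b d e : ℕ) : Momentum :=
  ![x, a, b, d, e, -(x + a + b + d + e)]

/-- The last component squared is at most 2x² + 2(4a)², so the sum of squares is at most 3x² + 36a²;
`1 ≤ a` absorbs x² and m² into multiples of a². -/
theorem bareWeight_latticeMomentum_ge (hm : 0 < m) (x : ℤ) {a b d e : ℕ} (ha : 1 ≤ a)
    (hb : b ≤ a) (hd : d ≤ a) (he : e ≤ a) :
    1 / ((3 * x ^ 2 + 36 + m ^ 2) * a ^ 2) ≤ bareWeight m (latticeMomentum x a b d e) := by
  have hpos : 0 < ∑ c, (latticeMomentum x a b d e c : ℝ) ^ 2 + m ^ 2 :=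
    add_pos_of_nonneg_of_pos (Finset.sum_nonneg fun _ _ => sq_nonneg _) (pow_pos hm 2)
  refine one_div_le_one_div_of_le hpos ?_
  have ha' : (1 : ℝ) ≤ a := by exact_mod_cast ha
  have hb' : (b : ℝ) ≤ a := by exact_mod_cast hb
  have hd' : (d : ℝ) ≤ a := by exact_mod_cast hd
  have he' : (e : ℝ) ≤ a := by exact_mod_cast he
  have hb0 : (0 : ℝ) ≤ b := b.cast_nonneg
  have hd0 : (0 : ℝ) ≤ d := d.cast_nonneg
  have he0 : (0 : ℝ) ≤ e := e.cast_nonneg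
  have ha2 : (1 : ℝ) ≤ a ^ 2 := one_le_pow₀ ha'
  have h₁ : (x + a + b + d + e : ℝ) ^ 2 ≤ 2 * x ^ 2 + 2 * (a + b + d + e) ^ 2 := by
    nlinarith [sq_nonneg (x - (a + b + d + e) : ℝ)]
  have h₂ : (a + b + d + e : ℝ) ^ 2 ≤ (4 * a) ^ 2 := pow_le_pow_left₀ (by linarith) (by linarith) 2
  have h₃ : (b : ℝ) ^ 2 ≤ a ^ 2 := pow_le_pow_left₀ hb0 hb' 2
  have h₄ : (d : ℝ) ^ 2 ≤ a ^ 2 := pow_le_pow_left₀ hd0 hd' 2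
  have h₅ : (e : ℝ) ^ 2 ≤ a ^ 2 := pow_le_pow_left₀ he0 he' 2
  have h₆ : (x : ℝ) ^ 2 ≤ x ^ 2 * a ^ 2 := le_mul_of_one_le_right (sq_nonneg _) ha2
  have h₇ : m ^ 2 ≤ m ^ 2 * a ^ 2 := le_mul_of_one_le_right (sq_nonneg _) ha2
  have hsum : ∑ c, (latticeMomentum x a b d e c : ℝ) ^ 2 =
      x ^ 2 + a ^ 2 + b ^ 2 + d ^ 2 + e ^ 2 + (x + a + b + d + e : ℝ) ^ 2 := by
    simp only [Fin.sum_univ_six, latticeMomentum]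
    simp only [Matrix.cons_val]
    push_cast
    ring
  rw [hsum]
  linarith

/-- The logarithmic divergence of the sum of the squared propagators at fixed component of
colour `0`. -/
theorem exists_le_sum_bareWeight_sq (hm : 0 < m) (x : ℤ) (B : ℝ) :
    ∃ T : Finset Momentum, (∀ r ∈ T, ∑ c, r c = 0 ∧ r 0 = x) ∧
      B ≤ ∑ r ∈ T, bareWeight m r ^ 2 := by
  classical
  set A : ℝ := 3 * x ^ 2 + 36 + m ^ 2 with hA
  have hApos : 0 < A := by positivity
  obtain ⟨R, hR⟩ := (Real.tendsto_sum_range_one_div_nat_succ_atTop.eventually_ge_atTop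
    (B * A ^ 2)).exists
  -- For a = i + 1 there are (i + 1)³ points, each of squared weight at least 1 / (A² (i + 1)⁴): the
  -- harmonic series.
  let I : Finset (Σ _ : ℕ, ℕ × ℕ × ℕ) := (Finset.range R).sigma fun i =>
    Finset.range (i + 1) ×ˢ Finset.range (i + 1) ×ˢ Finset.range (i + 1)
  let r : (Σ _ : ℕ, ℕ × ℕ × ℕ) → Momentum := fun s =>
    latticeMomentum x (s.1 + 1) s.2.1 s.2.2.1 s.2.2.2
  have hr : Function.Injective r := by
    rintro ⟨i, b, d, e⟩ ⟨i', b', d', e'⟩ h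
    have h₁ := congrFun h 1
    have h₂ := congrFun h 2
    have h₃ := congrFun h 3
    have h₄ := congrFun h 4
    simp only [r, latticeMomentum, Matrix.cons_val] at h₁ h₂ h₃ h₄
    obtain rfl : i = i' := by omega
    obtain rfl : b = b' := by omega
    obtain rfl : d = d' := by omega
    obtain rfl : e = e' := by omega
    rfl
  refine ⟨I.image r, ?_, ?_⟩
  · intro p hp
    obtain ⟨s, -, rfl⟩ := Finset.mem_image.1 hp
    refine ⟨?_, rfl⟩
    simp only [r, latticeMomentum, Fin.sum_univ_six, Matrix.cons_val]
    ring
  · rw [Finset.sum_image hr.injOn, Finset.sum_sigma]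
    have h : ∀ i ∈ Finset.range R, 1 / ((i : ℝ) + 1) / A ^ 2 ≤
        ∑ t ∈ Finset.range (i + 1) ×ˢ Finset.range (i + 1) ×ˢ Finset.range (i + 1),
          bareWeight m (r ⟨i, t⟩) ^ 2 := by
      intro i _
      have hterm : ∀ t ∈ Finset.range (i + 1) ×ˢ Finset.range (i + 1) ×ˢ Finset.range (i + 1),
          (1 / (A * ((i + 1 : ℕ) : ℝ) ^ 2)) ^ 2 ≤ bareWeight m (r ⟨i, t⟩) ^ 2 := by
        rintro ⟨b, d, e⟩ ht
        simp only [Finset.mem_product, Finset.mem_range] at ht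
        obtain ⟨hb, hd, he⟩ := ht
        exact pow_le_pow_left₀ (by positivity)
          (bareWeight_latticeMomentum_ge hm x (a := i + 1) (b := b) (d := d) (e := e)
            (by omega) hb.le hd.le he.le) 2
      refine le_trans (le_of_eq ?_) (Finset.card_nsmul_le_sum _ _ _ hterm)
      rw [Finset.card_product, Finset.card_product, Finset.card_range, nsmul_eq_mul]
      push_cast
      field_simp
    refine le_trans ?_ (Finset.sum_le_sum h)
    rw [← Finset.sum_div, le_div_iff₀ (by positivity)]
    exact hR

/-- Keep only attributions in which one disk has momentum `r` and all others `q`. An unciliated leaf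
is chosen if there is one; otherwise the centre, which has `N` lines, one or two. A single
propagator dominates m² times its square by `hsq`. -/
theorem star_amplitude_lower_bound {k N : ℕ} (hN : N ≤ k + 1) (hN1 : 1 ≤ N) (hN2 : N ≤ 2)
    (hm : 0 < m) (hM : 1 < M) (x : ℤ) :
    ∃ a : ℝ, 0 < a ∧ ∀ T : Finset Momentum, (∀ r ∈ T, ∑ c, r c = 0 ∧ r 0 = x) →
      ∀ᶠ ρ in atTop, a * ∑ r ∈ T, bareWeight m r ^ 2 ≤
        (star hN).amplitude m M ρ fun _ => momentumOf x := by
  classical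
  set q : Momentum := (momentumOf x).1 with hq
  suffices h : ∃ a : ℝ, 0 < a ∧ ∃ K : Momentum → Half (k + 1) → Momentum, Function.Injective K ∧
      ∀ r : Momentum, r 0 = x → ∀ ρ, propagator m M ρ q = bareWeight m q →
        propagator m M ρ r = bareWeight m r →
        a * bareWeight m r ^ 2 ≤ (star hN).summand m M ρ (fun _ => momentumOf x) (K r) by
    obtain ⟨a, ha, K, hK, h⟩ := h
    refine ⟨a, ha, fun T hT => ?_⟩
    filter_upwards [eventually_propagator_eq (m := m) hM (momentumOf x).2,
      (Finset.eventually_all T).2 fun r hr => eventually_propagator_eq (m := m) hM (hT r hr).1]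
      with ρ h₁ h₂
    refine le_trans ?_ ((star hN).sum_summand_le_amplitude m M ρ _ (T.image K))
    rw [Finset.sum_image hK.injOn, Finset.mul_sum]
    exact Finset.sum_le_sum fun r hr => h r (hT r hr).2 ρ h₁ (h₂ r hr)
  have hm2 : 0 < m ^ 2 := pow_pos hm 2
  have hsq : ∀ r, m ^ 2 * bareWeight m r ^ 2 ≤ bareWeight m r := by
    intro r
    have := mul_le_mul_of_nonneg_right (mul_bareWeight_le_one hm r) (bareWeight_pos hm r).le
    rwa [one_mul, mul_assoc, ← sq] at this
  rcases Nat.lt_or_ge N (k + 1) with hk | hk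
  · let s : (star hN).Line := ⟨(⟨N, hk⟩, true), by
      rintro ⟨j, hj⟩
      have h := congrArg (fun d : Half (k + 1) => (d.1 : ℕ)) hj
      simp only [star_cilium, Fin.val_castLE] at h
      omega⟩
    let e : ℕ := ((Finset.univ : Finset (star hN).Line).erase s).card
    refine ⟨m ^ 2 * bareWeight m q ^ e, mul_pos hm2 (pow_pos (bareWeight_pos hm q) e),
      fun r d => if d = s.1 then r else q, ?_, ?_⟩
    · intro r r' h
      simpa using congrFun h s.1
    · intro r hr ρ h₁ h₂
      rw [star_summand, ← Finset.mul_prod_erase _ _ (Finset.mem_univ s)]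
      · have hrest : ∏ l ∈ (Finset.univ : Finset (star hN).Line).erase s,
            propagator m M ρ (if l.1 = s.1 then r else q) = bareWeight m q ^ e := by
          refine Finset.prod_eq_pow_card fun l hl => ?_
          rw [if_neg fun h => Finset.ne_of_mem_erase hl (Subtype.ext h), h₁]
        simp only [if_true, h₂]
        rw [hrest, mul_right_comm]
        exact mul_le_mul_of_nonneg_right (hsq r) (pow_pos (bareWeight_pos hm q) e).le
      · intro j
        refine if_neg fun h => s.2 ⟨j, h⟩
      · intro v
        simp [s]
      · intro v
        have : q 0 = x := rfl
        by_cases hv : v = ⟨N, hk⟩ <;> simp [s, hv, hr, this]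
  · obtain rfl : N = k + 1 := le_antisymm hN hk
    have hline : ∀ l : (star hN).Line, l.1.2 = false := by
      rintro ⟨⟨v, b⟩, hl⟩
      cases b
      · rfl
      · exact (hl ⟨v, rfl⟩).elim
    refine ⟨min (m ^ 2) 1, lt_min hm2 one_pos, fun r d => if d.2 then q else r, ?_, ?_⟩
    · intro r r' h
      simpa using congrFun h (0, false)
    · intro r hr ρ _ h₂
      rw [star_summand]
      · simp only [hline, Bool.false_eq_true, if_false, Finset.prod_const, h₂, Finset.card_univ]
        have hcard := (star hN).card_line_add
        have hw := sq_nonneg (bareWeight m r)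
        obtain h | h : Fintype.card (star hN).Line = 1 ∨ Fintype.card (star hN).Line = 2 := by
          omega
        · rw [h, pow_one]
          exact (mul_le_mul_of_nonneg_right (min_le_left _ _) hw).trans (hsq r)
        · rw [h]
          exact (mul_le_mul_of_nonneg_right (min_le_right _ _) hw).trans (one_mul _).le
      · intro j
        rfl
      · intro v
        rfl
      · intro v
        simp [hr, hq, momentumOf_zero]

theorem tendsto_star_amplitude {k N : ℕ} (hN : N ≤ k + 1) (hN1 : 1 ≤ N) (hN2 : N ≤ 2)
    (hm : 0 < m) (hM : 1 < M) (x : ℤ) :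
    Tendsto (fun ρ => (star hN).amplitude m M ρ fun _ => momentumOf x) atTop atTop := by
  obtain ⟨a, ha, h⟩ := star_amplitude_lower_bound hN hN1 hN2 hm hM x
  rw [tendsto_atTop]
  intro B
  obtain ⟨T, hT, hB⟩ := exists_le_sum_bareWeight_sq hm x (B / a)
  filter_upwards [h T hT] with ρ hρ
  refine le_trans ?_ hρ
  rwa [div_le_iff₀' ha] at hB

end Divergences

end TGFT

namespace TGFT

open Equiv Module Filter FeynmanGraph

/-! ### Generating functions -/

section FeynmanSum

variable (m M : ℝ) {N : ℕ}

/-- The sum of the amplitudes of the graphs of order `n` in the class `S`. -/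
noncomputable def amplitudeSum (S : GraphClass N) (ρ : ℕ) (p : Fin N → GaugeMomentum) (n : ℕ) : ℝ :=
  open Classical in ∑ G : FeynmanGraph n N, if G ∈ S n then G.amplitude m M ρ p else 0

theorem coeff_feynmanSum (S : GraphClass N) (ρ : ℕ) (p : Fin N → GaugeMomentum) (n : ℕ) :
    PowerSeries.coeff n (feynmanSum m M S ρ p) =
      (-1) ^ n / (n.factorial : ℝ) * amplitudeSum m M S ρ p n :=
  PowerSeries.coeff_mk _ _

/-- A cilium needs a vertex; this is why a factor of the coupling can be extracted. -/
theorem amplitudeSum_zero (hN : 1 ≤ N) (S : GraphClass N) (ρ : ℕ) (p : Fin N → GaugeMomentum) :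
    amplitudeSum m M S ρ p 0 = 0 :=
  Finset.sum_eq_zero fun G _ => (G.cilium ⟨0, hN⟩).1.elim0

theorem amplitude_le_amplitudeSum {S : GraphClass N} (ρ : ℕ) (p : Fin N → GaugeMomentum) {n : ℕ}
    {G : FeynmanGraph n N} (hG : G ∈ S n) : G.amplitude m M ρ p ≤ amplitudeSum m M S ρ p n := by
  classical
  have h := Finset.single_le_sum
    (f := fun G : FeynmanGraph n N => if G ∈ S n then G.amplitude m M ρ p else 0)
    (fun G _ => ?_) (Finset.mem_univ G)
  · simpa only [if_pos hG, amplitudeSum] using h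
  · split_ifs
    exacts [G.amplitude_nonneg m M ρ p, le_rfl]

theorem feynmanSum_sub {S T : GraphClass N} (h : ∀ n, T n ⊆ S n) :
    feynmanSum m M S - feynmanSum m M T = feynmanSum m M (S \ T) := by
  classical
  ext ρ p n
  rw [Pi.sub_apply, Pi.sub_apply, map_sub]
  simp only [coeff_feynmanSum]
  rw [← mul_sub, amplitudeSum, amplitudeSum, amplitudeSum, ← Finset.sum_sub_distrib]
  congr 1
  refine Finset.sum_congr rfl fun G _ => ?_
  have hmem : G ∈ (S \ T) n ↔ G ∈ S n ∧ G ∉ T n := Iff.rfl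
  simp only [hmem]
  by_cases hT : G ∈ T n
  · simp [hT, h n hT]
  · simp [hT]

theorem sum_feynmanSum {ι : Type*} [Fintype ι] {T : ι → GraphClass N}
    (h : ∀ n (G : FeynmanGraph n N) c c', G ∈ T c n → G ∈ T c' n → c = c') :
    ∑ c, feynmanSum m M (T c) = feynmanSum m M fun n => ⋃ c, T c n := by
  classical
  ext ρ p n
  rw [Finset.sum_apply, Finset.sum_apply, map_sum]
  simp only [coeff_feynmanSum]
  rw [← Finset.mul_sum]
  simp only [amplitudeSum]
  rw [Finset.sum_comm]
  congr 1
  refine Finset.sum_congr rfl fun G _ => ?_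
  by_cases hG : ∃ c, G ∈ T c n
  · obtain ⟨c, hc⟩ := hG
    rw [if_pos (Set.mem_iUnion.2 ⟨c, hc⟩), Finset.sum_eq_single c, if_pos hc]
    · intro c' _ hne
      exact if_neg fun hc' => hne (h n G c' c hc' hc)
    · intro hc'
      exact (hc' (Finset.mem_univ c)).elim
  · rw [if_neg (fun hG' => hG (Set.mem_iUnion.1 hG')), Finset.sum_eq_zero]
    exact fun c _ => if_neg fun hc => hG ⟨c, hc⟩

/-- A bijection of the graphs that preserves the amplitudes preserves their sum. -/
theorem amplitudeSum_congr {S S' : GraphClass N} {ρ : ℕ} {p p' : Fin N → GaugeMomentum} {n : ℕ}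
    (e : FeynmanGraph n N ≃ FeynmanGraph n N) (hS : ∀ G, e G ∈ S' n ↔ G ∈ S n)
    (he : ∀ G ∈ S n, G.amplitude m M ρ p = (e G).amplitude m M ρ p') :
    amplitudeSum m M S ρ p n = amplitudeSum m M S' ρ p' n := by
  classical
  refine Fintype.sum_equiv e _ _ fun G => ?_
  by_cases hG : G ∈ S n
  · rw [if_pos hG, if_pos ((hS G).2 hG), he G hG]
  · rw [if_neg hG, if_neg (fun h => hG ((hS G).1 h))]

/-- The class `S` shifted by one order, as a function of a single strand momentum. -/
noncomputable def strandSeries (S : GraphClass N) (ρ : ℕ) (q : ℤ) : PowerSeries ℝ :=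
  PowerSeries.mk fun k => (-1) ^ k / ((k + 1).factorial : ℝ) *
    amplitudeSum m M S ρ (fun _ => momentumOf q) (k + 1)

theorem coeff_strandSeries (S : GraphClass N) (ρ : ℕ) (q : ℤ) (k : ℕ) :
    PowerSeries.coeff k (strandSeries m M S ρ q) = (-1) ^ k / ((k + 1).factorial : ℝ) *
      amplitudeSum m M S ρ (fun _ => momentumOf q) (k + 1) :=
  PowerSeries.coeff_mk _ _

variable {m M}

/-- All graphs of one order have the same sign, so nothing can cancel the divergence of the star. -/
theorem strandSeries_divergesAtOrder (hm : 0 < m) (hM : 1 < M) {S : GraphClass N} {k : ℕ}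
    (hN : N ≤ k + 1) (hN1 : 1 ≤ N) (hN2 : N ≤ 2) (hS : star hN ∈ S (k + 1)) (q : ℤ) :
    DivergesAtOrder (fun ρ => strandSeries m M S ρ q) k := by
  have hpos : 0 < 1 / ((k + 1).factorial : ℝ) := by positivity
  refine tendsto_atTop_mono (fun ρ => ?_)
    ((tendsto_star_amplitude hN hN1 hN2 hm hM q).const_mul_atTop hpos)
  rw [coeff_strandSeries, abs_mul, abs_div, abs_pow, abs_neg, abs_one, one_pow, Nat.abs_cast]
  exact mul_le_mul_of_nonneg_left
    ((amplitude_le_amplitudeSum m M ρ _ hS).trans (le_abs_self _)) hpos.le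

end FeynmanSum

/-- The melonic one-particle irreducible graphs whose ciliated disks all have an edge of colour
`c`. -/
def onePIMelonicRoot (N : ℕ) (c : Fin 6) : GraphClass N :=
  fun _ => {G | G.IsOnePI ∧ G.IsMelonic ∧ ∀ j, G.color (G.cilium j).1 = c}

/-! ### Form of the melonic two- and four-point functions -/

section VertexFunctions

variable (m M : ℝ)

theorem swap_apply_eq_zero {c a : Fin 6} : swap c 0 a = 0 ↔ a = c := by
  rw [swap_apply_eq_iff, swap_apply_right]

theorem recolor_swap_mem_onePIMelonicRoot {N n : ℕ} (c : Fin 6) (G : FeynmanGraph n N) :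
    recolor (swap c 0) G ∈ onePIMelonicRoot N 0 n ↔ G ∈ onePIMelonicRoot N c n := by
  simp only [onePIMelonicRoot, Set.mem_ofPred_eq, recolor_isOnePI]
  refine and_congr_right fun h => ?_
  rw [recolor_isMelonic h]
  refine and_congr_right fun _ => forall_congr' fun j => ?_
  rw [recolor_color]
  exact swap_apply_eq_zero

theorem recolor_swap_mem_onePIMelonicMono {n : ℕ} (c : Fin 6) (G : FeynmanGraph n 2) :
    recolor (swap c 0) G ∈ onePIMelonicMono 0 n ↔ G ∈ onePIMelonicMono c n := by
  have hmono := recolor_isMono (G := G) (swap c 0) c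
  rw [swap_apply_left] at hmono
  simp only [onePIMelonicMono, Set.mem_ofPred_eq, recolor_isOnePI, hmono]
  refine and_congr_right fun h => ?_
  rw [recolor_isMelonic h]

/-- Sort the graphs by the colour of the edge at the ciliated leaf, then recolour it to 0. -/
theorem vertexTwoMelo_eq (ρ : ℕ) (p : GaugeMomentum) :
    vertexTwoMelo m M ρ (fun _ => p) =
      -(PowerSeries.X * ∑ c, strandSeries m M (onePIMelonicRoot 1 0) ρ (p.1 c)) := by
  classical
  ext n
  rw [vertexTwoMelo, coeff_feynmanSum, map_neg]
  cases n with
  | zero => rw [amplitudeSum_zero m M le_rfl, mul_zero, PowerSeries.coeff_zero_X_mul, neg_zero]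
  | succ k =>
    rw [PowerSeries.coeff_succ_X_mul, map_sum]
    simp only [coeff_strandSeries]
    have h : ∀ c, amplitudeSum m M (onePIMelonicRoot 1 0) ρ (fun _ => momentumOf (p.1 c)) (k + 1) =
        amplitudeSum m M (onePIMelonicRoot 1 c) ρ (fun _ => p) (k + 1) := fun c =>
      (amplitudeSum_congr m M (recolor (swap c 0)) (recolor_swap_mem_onePIMelonicRoot c)
        fun G hG => hG.1.amplitude_eq m M ρ hG.2.1 hG.2.2 fun _ => rfl).symm
    have hsum : amplitudeSum m M (onePIMelonic 1) ρ (fun _ => p) (k + 1) =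
        ∑ c, amplitudeSum m M (onePIMelonicRoot 1 c) ρ (fun _ => p) (k + 1) := by
      simp only [amplitudeSum]
      rw [Finset.sum_comm]
      refine Finset.sum_congr rfl fun G _ => ?_
      have hmem : ∀ c, G ∈ onePIMelonicRoot 1 c (k + 1) ↔
          G.color (G.cilium 0).1 = c ∧ G ∈ onePIMelonic 1 (k + 1) := by
        intro c
        constructor
        · rintro ⟨h₁, h₂, h₃⟩
          exact ⟨h₃ 0, h₁, h₂⟩
        · rintro ⟨h₁, h₂, h₃⟩
          refine ⟨h₂, h₃, fun j => ?_⟩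
          rwa [Subsingleton.elim j 0]
      simp only [hmem, ite_and, Finset.sum_ite_eq, Finset.mem_univ, if_true]
    simp only [h]
    rw [hsum, ← Finset.mul_sum]
    ring

theorem vertexFourMonoMelo_eq (ρ : ℕ) (c : Fin 6) (p p' : GaugeMomentum) :
    vertexFourMonoMelo m M c ρ ![p, p'] =
      -(PowerSeries.X * (if p.1 c = p'.1 c then 1 else 0) *
        strandSeries m M (onePIMelonicMono 0) ρ (p.1 c)) := by
  classical
  ext n
  rw [vertexFourMonoMelo, coeff_feynmanSum, map_neg]
  split_ifs with hp
  · rw [mul_one]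
    cases n with
    | zero =>
      rw [amplitudeSum_zero m M one_le_two, mul_zero, PowerSeries.coeff_zero_X_mul, neg_zero]
    | succ k =>
      rw [PowerSeries.coeff_succ_X_mul, coeff_strandSeries,
        amplitudeSum_congr m M (recolor (swap c 0)) (recolor_swap_mem_onePIMelonicMono c)
          (p' := fun _ => momentumOf (p.1 c))]
      · ring
      · intro G hG
        refine hG.1.amplitude_eq m M ρ hG.2.1 (hG.1.color_cilium hG.2.1 hG.2.2) fun j => ?_
        fin_cases j
        exacts [rfl, hp.symm]
  · rw [mul_zero, zero_mul, map_zero, neg_zero, amplitudeSum, Finset.sum_eq_zero, mul_zero]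
    intro G _
    split_ifs with hG
    · have h : G.MonoLinked c (G.cilium 0) (G.cilium 1) := hG.2.2
      exact h.amplitude_eq_zero m M ρ hp
    · rfl

/-- The colour is that of the edge at a ciliated leaf, so the sum over colours counts no graph
twice. -/
theorem onePIMelonicMono_color_unique (n : ℕ) (G : FeynmanGraph n 2) (c c' : Fin 6)
    (h : G ∈ onePIMelonicMono c n) (h' : G ∈ onePIMelonicMono c' n) : c = c' :=
  (h.1.color_cilium h.2.1 h.2.2 0).symm.trans (h'.1.color_cilium h'.2.1 h'.2.2 0)

end VertexFunctions

end TGFT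

theorem mainTheorem2 (m M : ℝ) (hm : 0 < m) (hM : 1 < M) :
    (∃ f g : ℕ → ℤ → PowerSeries ℝ,
      (∀ (p : ℤ) (k : ℕ), TGFT.DivergesAtOrder (fun ρ => f ρ p) k) ∧
      (∀ (p : ℤ) (k : ℕ), 1 ≤ k → TGFT.DivergesAtOrder (fun ρ => g ρ p) k) ∧
      (∀ (ρ : ℕ) (p : TGFT.GaugeMomentum),
        TGFT.vertexTwoMelo m M ρ (fun _ => p) = -(PowerSeries.X * ∑ c, f ρ (p.1 c))) ∧
      (∀ (ρ : ℕ) (c : Fin 6) (p p' : TGFT.GaugeMomentum),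
        TGFT.vertexFourMonoMelo m M c ρ ![p, p'] =
          -(PowerSeries.X * (if p.1 c = p'.1 c then 1 else 0) * g ρ (p.1 c)))) ∧
    TGFT.IsSuperficiallyConvergent m M (TGFT.onePI 1 \ TGFT.onePIMelonic 1)
      (TGFT.vertexFunction m M 1 - TGFT.vertexTwoMelo m M) ∧
    (∀ c : Fin 6,
      TGFT.IsSuperficiallyConvergent m M (TGFT.onePIMono c \ TGFT.onePIMelonicMono c)
        (TGFT.vertexFourMono m M c - TGFT.vertexFourMonoMelo m M c)) ∧
    TGFT.IsSuperficiallyConvergent m M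
      (TGFT.onePI 2 \ fun n => ⋃ c, TGFT.onePIMelonicMono c n)
      (TGFT.vertexFunction m M 2 - ∑ c, TGFT.vertexFourMonoMelo m M c) ∧
    (∀ N : ℕ, 3 ≤ N →
      TGFT.IsSuperficiallyConvergent m M (TGFT.onePI N) (TGFT.vertexFunction m M N)) := by
  refine ⟨⟨TGFT.strandSeries m M (TGFT.onePIMelonicRoot 1 0),
    TGFT.strandSeries m M (TGFT.onePIMelonicMono 0), ?_, ?_, TGFT.vertexTwoMelo_eq m M,
    TGFT.vertexFourMonoMelo_eq m M⟩, ⟨?_, ?_⟩, fun c => ⟨?_, ?_⟩, ⟨?_, ?_⟩, fun N hN => ⟨rfl, ?_⟩⟩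
  · intro p k
    have h : 1 ≤ k + 1 := Nat.le_add_left 1 k
    exact TGFT.strandSeries_divergesAtOrder hm hM h le_rfl one_le_two
      (show TGFT.star h ∈ TGFT.onePIMelonicRoot 1 0 (k + 1) from
        ⟨TGFT.star_isOnePI h, TGFT.star_isMelonic h, fun _ => rfl⟩) p
  · intro p k hk
    have h : 2 ≤ k + 1 := Nat.succ_le_succ hk
    exact TGFT.strandSeries_divergesAtOrder hm hM h one_le_two le_rfl
      (show TGFT.star h ∈ TGFT.onePIMelonicMono 0 (k + 1) from
        ⟨TGFT.star_isOnePI h, TGFT.star_isMelonic h, TGFT.star_isMono h⟩) p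
  · exact TGFT.feynmanSum_sub m M fun _ _ hG => hG.1
  · rintro n G ⟨h₁, h₂⟩
    exact G.divergenceDegree_neg_of_not_isMelonic (TGFT.FeynmanGraph.IsOnePI.isLinked h₁) le_rfl
      fun h => h₂ ⟨h₁, h⟩
  · exact TGFT.feynmanSum_sub m M fun _ _ hG => ⟨hG.1, hG.2.2⟩
  · rintro n G ⟨h₁, h₂⟩
    exact G.divergenceDegree_neg_of_not_isMelonic (TGFT.FeynmanGraph.IsOnePI.isLinked h₁.1)
      one_le_two fun h => h₂ ⟨h₁.1, h, h₁.2⟩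
  · have h := TGFT.sum_feynmanSum m M TGFT.onePIMelonicMono_color_unique
    refine (congrArg (TGFT.vertexFunction m M 2 - ·) h).trans
      (TGFT.feynmanSum_sub m M fun n G hG => ?_)
    obtain ⟨c, hc⟩ := Set.mem_iUnion.1 hG
    exact hc.1
  · rintro n G ⟨h₁, h₂⟩
    have hlinked := TGFT.FeynmanGraph.IsOnePI.isLinked h₁
    by_cases hmel : G.IsMelonic
    · exact G.divergenceDegree_neg_of_not_isMono hlinked fun c hc =>
        h₂ (Set.mem_iUnion.2 ⟨c, h₁, hmel, hc⟩)
    · exact G.divergenceDegree_neg_of_not_isMelonic hlinked one_le_two hmel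
  · intro n G hG
    exact G.divergenceDegree_neg_of_three_le (TGFT.FeynmanGraph.IsOnePI.isLinked hG) hN
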